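/- Notation. Let $d\in\mathbb N$. For $\mathbf k\in\mathbb Z^d$ put $|\mathbf k|=\max_v|k_v|$ and $\langle\mathbf k\rangle=\max\{1,|\mathbf k|\}$; for $x\in\mathbb R$ let $\|x\|_{\mathbb R/\mathbb Z}=\inf_{k\in\mathbb Z}|x-k|$; for $\omega\in\mathbb R^d$ let $\mathbf i\cdot\omega=\sum_v i_v\omega_v$. For a real sequence $\phi=(\phi_{\mathbf i})_{\mathbf i\in\mathbb Z^d}$ let $(T_\phi u)_{\mathbf i}=\sum_{\mathbf j\in\mathbb Z^d}\phi_{\mathbf i-\mathbf j}u_{\mathbf j}$ and $\|T_\phi\|_\sigma=\big(\sum_{\mathbf k}|\phi_{\mathbf k}|^2\langle\mathbf k\rangle^{2\sigma}\big)^{1/2}$. For $r>0$ let $\mathcal D_r=\{z\in\mathbb C:|\Im z|<r\}$, and let $\mathfrak P_r$ be the set of meromorphic functions $f$ of period $1$ on $\mathcal D_r$ for which there is $c>0$ with $|f(z)-f(z-x)|\ge c\,\|x\|_{\mathbb R/\mathbb Z}$ for all $z\in\mathcal D_r$ and $x\in\mathbb R$ such that neither $z$ nor $z-x$ is a pole of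 $f$. An operator on $\ell^2(\mathbb Z^d)$ (possibly unbounded and non-normal) is said to have pure point spectrum if it has a complete set of eigenfunctions, i.e. the closed linear span of its eigenfunctions is $\ell^2(\mathbb Z^d)$. Statement. Fix $\alpha_0>d/2$, $\tau>0$, $\gamma>0$, $\delta>0$ and $s>\alpha_0+\tau+d/2+12\delta$. Let $r>0$ and $f\in\mathfrak P_r$. Then there is $\epsilon_0=\epsilon_0(f,r,s,d,\delta,\tau,\gamma,\alpha_0)>0$ such that the following holds for every $\omega\in\mathbb R^d$ with $$\|\mathbf i\cdot\omega\|_{\mathbb R/\mathbb Z}\ge\frac{\gamma}{|\mathbf i|^\tau}\quad\text{for all }\mathbf i\in\mathbb Z^d\setminus\{\mathbf 0\}$$ such that no point $\mathbf i\cdot\omega$ ($\mathbf i\in\mathbb Z^d$) is a pole of $f$, and every real $\phi$ with $\phi_{\mathbf 0}=0$, $|\phi_{\mathbf i}|\le|\mathbf i|^{-s}$ for $\mathbf i\ne\mathbf 0$, and $\|T_\phi\|_{s-d/2-\delta}\le\epsilon_0$. The operator $$H=T_\phi+f(\mathbf i\cdot\omega)\,\delta_{\mathbf i\mathbf i'}$$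 on $\ell^2(\mathbb Z^d)$, with its natural (maximal) domain, has pure point spectrum with a complete set of polynomially localized eigenfunctions $\{e_{\mathbf k}\}_{\mathbf k\in\mathbb Z^d}$ satisfying $$|(e_{\mathbf k})_{\mathbf i}|\le 2\langle\mathbf i-\mathbf k\rangle^{-s+\tau+d/2+12\delta}\quad\text{for all }\mathbf i,\mathbf k\in\mathbb Z^d.$$ In particular, the same conclusion holds (each time with some $\epsilon_0(s,d,\delta,\tau,\gamma,\alpha_0)>0$, and without any assumption on poles) for $H=T_\phi+\tan(\pi\,\mathbf i\cdot\omega)\,\delta_{\mathbf i\mathbf i'}$ and for $H=T_\phi+\exp(2\pi\sqrt{-1}\,\mathbf i\cdot\omega)\,\delta_{\mathbf i\mathbf i'}$. -/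

import Mathlib

noncomputable section

/-- The lattice `ℤ^d`; its norm `‖k‖` is the sup norm `max_v |k_v|`. -/
abbrev ZLat (d : ℕ) : Type := Fin d → ℤ

/-- The complex Hilbert space `ℓ²(ℤ^d)`. -/
abbrev EllTwo (d : ℕ) : Type := lp (fun _ : ZLat d => ℂ) 2

/-- `⟨k⟩ = max {1, |k|}`. -/
def bracket {d : ℕ} (k : ZLat d) : ℝ := max 1 ‖k‖

/-- `i · ω = ∑ v, i_v ω_v`. -/
def latDot {d : ℕ} (i : ZLat d) (ω : Fin d → ℝ) : ℝ := ∑ v, (i v : ℝ) * ω v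

/-- The Diophantine condition `‖i · ω‖_{ℝ/ℤ} ≥ γ / |i|^τ` for all `i ≠ 0`. The norm of
`UnitAddCircle = ℝ/ℤ` is the distance to the nearest integer. -/
def Diophantine {d : ℕ} (τ γ : ℝ) (ω : Fin d → ℝ) : Prop :=
  ∀ i : ZLat d, i ≠ 0 → γ / ‖i‖ ^ τ ≤ ‖(latDot i ω : UnitAddCircle)‖

/-- Real hopping symbols with `φ_0 = 0` and `|φ_i| ≤ |i|^{-s}` for `i ≠ 0`. -/
structure PolyHopping {d : ℕ} (s : ℝ) (φ : ZLat d → ℝ) : Prop where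
  zero : φ 0 = 0
  decay : ∀ i : ZLat d, i ≠ 0 → |φ i| ≤ ‖i‖ ^ (-s)

/-- The Sobolev norm `‖T_φ‖_σ = (∑_k |φ_k|² ⟨k⟩^{2σ})^{1/2}` of the Toeplitz operator `T_φ`. The
`k`-th diagonal of `T_φ` is the constant sequence `φ_k`, whose norm is `|φ_k|` in every translation
invariant Banach algebra of sequences in which the unit has norm one. -/
def hoppingNorm {d : ℕ} (σ : ℝ) (φ : ZLat d → ℝ) : ℝ :=
  Real.sqrt (∑' k : ZLat d, |φ k| ^ 2 * bracket k ^ (2 * σ))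

/-- `(T_φ u)_i = ∑_j φ_{i-j} u_j`. -/
def hop {d : ℕ} (φ : ZLat d → ℝ) (u : ZLat d → ℂ) (i : ZLat d) : ℂ :=
  ∑' j : ZLat d, (φ (i - j) : ℂ) * u j

theorem hop_add {d : ℕ} {φ : ZLat d → ℝ} {u v : ZLat d → ℂ} {i : ZLat d}
    (hu : Summable fun j => (φ (i - j) : ℂ) * u j) (hv : Summable fun j => (φ (i - j) : ℂ) * v j) :
    hop φ (u + v) i = hop φ u i + hop φ v i := by
  simp only [hop, Pi.add_apply, mul_add]
  exact hu.tsum_add hv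

theorem hop_smul {d : ℕ} (φ : ZLat d → ℝ) (c : ℂ) (u : ZLat d → ℂ) (i : ZLat d) :
    hop φ (c • u) i = c * hop φ u i := by
  simp only [hop, Pi.smul_apply, smul_eq_mul, mul_left_comm _ c]
  exact tsum_mul_left

/-- The natural domain of `T_φ + diag(D)`: those `u ∈ ℓ²` for which all sums `∑_j φ_{i-j} u_j`
converge and the result lies in `ℓ²`. If `φ ∈ ℓ¹`, then `T_φ` is bounded and this is the domain
`{u ∈ ℓ² | D u ∈ ℓ²}` of the diagonal part. -/
def latticeDomain {d : ℕ} (φ : ZLat d → ℝ) (D : ZLat d → ℂ) : Submodule ℂ (EllTwo d) where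
  carrier := {u | (∀ i, Summable fun j => (φ (i - j) : ℂ) * u j) ∧
    Memℓp (fun i => hop φ (fun j => u j) i + D i * u i) 2}
  zero_mem' := by
    refine ⟨fun i => by simp, ?_⟩
    have h : (fun i => hop φ (fun j => (0 : EllTwo d) j) i + D i * (0 : EllTwo d) i) = 0 := by
      funext i; simp [hop]
    rw [h]
    exact zero_memℓp
  add_mem' := by
    rintro u v ⟨hu, hu'⟩ ⟨hv, hv'⟩
    refine ⟨fun i => ?_, ?_⟩
    · simpa [mul_add] using (hu i).add (hv i)
    · convert hu'.add hv' using 1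
      funext i
      have := hop_add (hu i) (hv i)
      change hop φ ((fun j => u j) + fun j => v j) i + D i * (u i + v i) =
        (hop φ (fun j => u j) i + D i * u i) + (hop φ (fun j => v j) i + D i * v i)
      rw [this]
      ring
  smul_mem' := by
    rintro c u ⟨hu, hu'⟩
    refine ⟨fun i => ?_, ?_⟩
    · simpa [mul_left_comm] using (hu i).mul_left c
    · convert hu'.const_smul c using 1
      funext i
      change hop φ (c • fun j => u j) i + D i * (c * u i) =
        c * (hop φ (fun j => u j) i + D i * u i)
      rw [hop_smul]
      ring

/-- The operator `T_φ + diag(D)` on `ℓ²(ℤ^d)`, with its natural domain. -/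
def latticeOp {d : ℕ} (φ : ZLat d → ℝ) (D : ZLat d → ℂ) : EllTwo d →ₗ.[ℂ] EllTwo d where
  domain := latticeDomain φ D
  toFun :=
    { toFun := fun u => ⟨fun i => hop φ (fun j => u.1 j) i + D i * u.1 i, u.2.2⟩
      map_add' := by
        intro u v
        ext i
        have := hop_add (u.2.1 i) (v.2.1 i)
        change hop φ ((fun j => u.1 j) + fun j => v.1 j) i + D i * (u.1 i + v.1 i) =
          (hop φ (fun j => u.1 j) i + D i * u.1 i) + (hop φ (fun j => v.1 j) i + D i * v.1 i)
        rw [this]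
        ring
      map_smul' := by
        intro c u
        ext i
        change hop φ (c • fun j => u.1 j) i + D i * (c * u.1 i) =
          c * (hop φ (fun j => u.1 j) i + D i * u.1 i)
        rw [hop_smul]
        ring }

/-- `u` is an eigenfunction of the (possibly unbounded) operator `H`. -/
def IsEigenfunction {d : ℕ} (H : EllTwo d →ₗ.[ℂ] EllTwo d) (u : EllTwo d) : Prop :=
  u ≠ 0 ∧ ∃ h : u ∈ H.domain, ∃ E : ℂ, H ⟨u, h⟩ = E • u

/-- A set of vectors is complete if its closed linear span is the whole space. -/
def IsCompleteSet {d : ℕ} (S : Set (EllTwo d)) : Prop :=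
  (Submodule.span ℂ S).topologicalClosure = ⊤

/-- An arbitrary (not necessarily normal) operator on `ℓ²(ℤ^d)` has pure point spectrum if its
eigenfunctions form a complete set. -/
def HasPurePointSpectrum {d : ℕ} (H : EllTwo d →ₗ.[ℂ] EllTwo d) : Prop :=
  IsCompleteSet {u | IsEigenfunction H u}

/-- `H` has pure point spectrum, with a complete set of eigenfunctions `e_k`, `k ∈ ℤ^d`, satisfying
`|(e_k)_i| ≤ 2 ⟨i - k⟩^{-q}`. -/
def PowerLawLocalized {d : ℕ} (H : EllTwo d →ₗ.[ℂ] EllTwo d) (q : ℝ) : Prop :=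
  HasPurePointSpectrum H ∧
    ∃ e : ZLat d → EllTwo d,
      (∀ k, IsEigenfunction H (e k)) ∧
      IsCompleteSet (Set.range e) ∧
      ∀ i k, ‖e k i‖ ≤ 2 * bracket (i - k) ^ (-q)

/-- The strip `{z | |Im z| < r}`. -/
def strip (r : ℝ) : Set ℂ := {z | |z.im| < r}

/-- The class `𝔓_r` of meromorphic functions `f` of period `1` on the strip with
`inf |f(z) - f(z - x)| ≥ c ‖x‖_{ℝ/ℤ}` over `x ∈ ℝ` and `z` in the strip. A meromorphic function is
represented by its normal form, which is analytic at every point that is not a pole; the difference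
counts as infinite at the poles, so only points where `f` is analytic impose a condition. -/
structure MeroClass (r : ℝ) (f : ℂ → ℂ) : Prop where
  meromorphic : MeromorphicNFOn f (strip r)
  periodic : ∀ z ∈ strip r, f (z + 1) = f z
  separated : ∃ c : ℝ, 0 < c ∧ ∀ z ∈ strip r, ∀ x : ℝ,
    AnalyticAt ℂ f z → AnalyticAt ℂ f (z - x) →
      c * ‖(x : UnitAddCircle)‖ ≤ ‖f z - f (z - x)‖

end

noncomputable section

/-! Write D = diag f(i·ω) and T = T_φ. If (D + T)(1 + Y) = (1 + Y)(D + g) with g diagonal, the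
columns of 1 + Y are eigenfunctions, with eigenvalues D_j + g_j. If Y is small and decays faster
than |i-j|^{-d}, they are complete: a vector u orthogonal to all of them satisfies |u_j| ≤ ½ sup|u|
for every j, hence vanishes. Neither normality of H nor an inverse of 1 + Y is needed
(`powerLawLocalized_of_defect_eq_zero`).

Y and g come from an iteration (`KamState.Valid.step`, `kamSeq_valid`). Given an approximate
solution with defect F, solve [D + g, W] = -(F - diag F), then replace 1 + Y by (1 + Y)(1 + W) and g
by g + diag F. The old hopping leaves the defect -YF + FW - (1 + Y)W diag F (`defect_step`), which
is F times something small. The contraction is linear, not quadratic, but its rate can be prescribed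
by taking φ small.

Solving for W costs a factor |k|^τ. The hopping is therefore switched on gradually: stage n uses
only |k| ≤ 2^n and measures matrices by e^{-|k|/2^n}⟨k⟩^{-b} with b > d. Passing to the next weight
turns |k|^τ into 2^{τn}. If |φ_k| ≤ κ⟨k⟩^{-(a+b)}, the shell added at stage n has size 2^{-an}.
Defects then stay of order 2^{-an} and corrections of order 2^{(τ-a)n}, which is summable for a > τ.
The remaining room buys extra decay ⟨k⟩^{-m} of Y for any m < a - τ (`exists_diagonalization`).

The divisors are controlled by holomorphy. All matrices have entries A_{i-j}(i·ω) with A_k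
holomorphic and 1-periodic on a strip. Separation makes 1/(f(z) - f(z - k·ω)) bounded, so it extends
across the poles (`exists_divisorInverse_of_separated`). Cauchy's estimate on shrinking strips keeps
g Lipschitz along the reals with constant at most c/2, so the corrected divisors lose at most a
factor 2. The smallness of κ comes from interpolating the decay of φ with its Sobolev norm
(`abs_le_of_polyHopping`). -/

/-! ### Brackets on the lattice. -/

theorem one_le_bracket {d : ℕ} (k : ZLat d) : 1 ≤ bracket k := le_max_left _ _

theorem bracket_pos {d : ℕ} (k : ZLat d) : 0 < bracket k := one_pos.trans_le (one_le_bracket k)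

theorem one_le_norm_of_ne_zero {d : ℕ} {k : ZLat d} (hk : k ≠ 0) : 1 ≤ ‖k‖ := by
  obtain ⟨v, hv⟩ := Function.ne_iff.mp hk
  refine le_trans ?_ (norm_le_pi_norm k v)
  rw [Int.norm_eq_abs]
  exact_mod_cast Int.one_le_abs hv

theorem bracket_eq_norm {d : ℕ} {k : ZLat d} (hk : k ≠ 0) : bracket k = ‖k‖ :=
  max_eq_right (one_le_norm_of_ne_zero hk)

theorem bracket_zero {d : ℕ} : bracket (0 : ZLat d) = 1 := by simp [bracket]

theorem bracket_le_add {d : ℕ} (k l : ZLat d) : bracket k ≤ bracket l + bracket (k - l) := by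
  have h : ‖k‖ ≤ ‖l‖ + ‖k - l‖ := by simpa using norm_add_le l (k - l)
  refine max_le ?_ ?_
  · linarith [one_le_bracket l, bracket_pos (k - l)]
  · exact h.trans (add_le_add (le_max_right _ _) (le_max_right _ _))

/-- ℤ^d is the standard lattice in ℝ^d, where norm powers below minus the rank are summable. Bracket
and norm differ only at 0, which a cofinite comparison ignores. -/
theorem summable_bracket_rpow {d : ℕ} {b : ℝ} (hb : (d : ℝ) < b) :
    Summable fun k : ZLat d => bracket k ^ (-b) := by
  let B := Pi.basisFun ℝ (Fin d)
  let L : Submodule ℤ (Fin d → ℝ) := Submodule.span ℤ (Set.range B)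
  have hL : (Module.finrank ℤ L : ℝ) = d := by
    rw [ZLattice.rank ℝ L]; simp
  have hmem : ∀ k : ZLat d, (fun v => (k v : ℝ)) ∈ L := by
    intro k
    have : (fun v => (k v : ℝ)) = ∑ v, k v • B v := by
      ext w
      simp [B, Finset.sum_apply, Pi.single_apply]
    rw [this]
    exact Submodule.sum_mem _ fun v _ => L.smul_mem _ (Submodule.subset_span ⟨v, rfl⟩)
  have hs := ZLattice.summable_norm_rpow L (-b) (by rw [hL]; linarith)
  have hinj : Function.Injective fun k : ZLat d => (⟨fun v => (k v : ℝ), hmem k⟩ : L) := by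
    intro k l h
    ext v
    have := congrFun (congrArg Subtype.val h) v
    simpa using this
  have h1 := hs.comp_injective hinj
  refine h1.congr_cofinite ?_
  filter_upwards [(Set.finite_singleton (0 : ZLat d)).compl_mem_cofinite] with k hk
  have hk : k ≠ 0 := hk
  have hn : ‖(⟨fun v => (k v : ℝ), hmem k⟩ : L)‖ = ‖k‖ := by
    change ‖fun v => (k v : ℝ)‖ = ‖k‖
    simp [Pi.norm_def]
    rfl
  simp only [Function.comp, hn, bracket_eq_norm hk]

/-! ### Convolution weights with exponential cutoff at range 2^n. -/

/-- A nonnegative weight `u` on `ℤ^d` with `u * u ≤ C u`. -/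
structure ConvWeight {d : ℕ} (C : ℝ) (u : ZLat d → ℝ) : Prop where
  nonneg : ∀ k, 0 ≤ u k
  summable : Summable u
  summable_mul : ∀ k, Summable fun l => u l * u (k - l)
  tsum_le : ∀ k, ∑' l, u l * u (k - l) ≤ C * u k

/-- The weight `e^{-|k|/2^n} ⟨k⟩^{-b}`. -/
def expWeight {d : ℕ} (b : ℝ) (n : ℕ) (k : ZLat d) : ℝ :=
  Real.exp (-‖k‖ / 2 ^ n) * bracket k ^ (-b)

theorem expWeight_nonneg {d : ℕ} (b : ℝ) (n : ℕ) (k : ZLat d) : 0 ≤ expWeight b n k :=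
  mul_nonneg (Real.exp_pos _).le (Real.rpow_nonneg (bracket_pos k).le _)

theorem expWeight_zero {d : ℕ} (b : ℝ) (n : ℕ) : expWeight b n (0 : ZLat d) = 1 := by
  simp [expWeight, bracket_zero]

theorem expWeight_le_bracket {d : ℕ} (b : ℝ) (n : ℕ) (k : ZLat d) :
    expWeight b n k ≤ bracket k ^ (-b) := by
  refine mul_le_of_le_one_left (Real.rpow_nonneg (bracket_pos k).le _) ?_
  rw [Real.exp_le_one_iff]
  have : 0 ≤ ‖k‖ / 2 ^ n := by positivity
  rw [neg_div]; linarith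

theorem expWeight_le_one {d : ℕ} {b : ℝ} (hb : 0 ≤ b) (n : ℕ) (k : ZLat d) :
    expWeight b n k ≤ 1 :=
  (expWeight_le_bracket b n k).trans
    (Real.rpow_le_one_of_one_le_of_nonpos (one_le_bracket k) (by linarith))

theorem expWeight_le_succ {d : ℕ} (b : ℝ) (n : ℕ) (k : ZLat d) :
    expWeight b n k ≤ expWeight b (n + 1) k := by
  refine mul_le_mul_of_nonneg_right ?_ (Real.rpow_nonneg (bracket_pos k).le _)
  rw [Real.exp_le_exp, neg_div, neg_div, neg_le_neg_iff]
  gcongr <;> norm_num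

/-- The larger of ⟨l⟩ and ⟨k-l⟩ is at least ⟨k⟩/2, so its power is replaced by that of ⟨k⟩ at cost
2^b, while the other factor stays summable. -/
theorem bracket_rpow_mul_le {d : ℕ} {b : ℝ} (hb : 0 ≤ b) (k l : ZLat d) :
    bracket l ^ (-b) * bracket (k - l) ^ (-b) ≤
      2 ^ b * bracket k ^ (-b) * (bracket l ^ (-b) + bracket (k - l) ^ (-b)) := by
  have aux : ∀ x y z : ℝ, 0 < x → 0 < y → 0 < z → x ≤ 2 * y →
      y ^ (-b) * z ^ (-b) ≤ 2 ^ b * x ^ (-b) * z ^ (-b) := by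
    intro x y z hx hy hz h
    refine mul_le_mul_of_nonneg_right ?_ (Real.rpow_nonneg hz.le _)
    have h2 : x ^ b ≤ 2 ^ b * y ^ b := by
      rw [← Real.mul_rpow (by norm_num) hy.le]
      exact Real.rpow_le_rpow hx.le h hb
    rw [Real.rpow_neg hx.le, Real.rpow_neg hy.le, ← div_eq_mul_inv, inv_eq_one_div,
      div_le_div_iff₀ (Real.rpow_pos_of_pos hy b) (Real.rpow_pos_of_pos hx b)]
    linarith
  have hk := bracket_pos k
  have hl := bracket_pos l
  have hm := bracket_pos (k - l)
  have hA : 0 ≤ 2 ^ b * bracket k ^ (-b) :=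
    mul_nonneg (Real.rpow_nonneg (by norm_num) _) (Real.rpow_nonneg hk.le _)
  rw [mul_add]
  rcases le_total (bracket l) (bracket (k - l)) with h | h
  · have := aux _ _ _ hk hm hl (by linarith [bracket_le_add k l])
    rw [mul_comm]
    linarith [mul_nonneg hA (Real.rpow_nonneg hm.le (-b))]
  · have := aux _ _ _ hk hl hm (by linarith [bracket_le_add k l])
    linarith [mul_nonneg hA (Real.rpow_nonneg hl.le (-b))]

theorem expWeight_mul_le {d : ℕ} {b : ℝ} (hb : 0 ≤ b) (n : ℕ) (k l : ZLat d) :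
    expWeight b n l * expWeight b n (k - l) ≤
      2 ^ b * expWeight b n k * (bracket l ^ (-b) + bracket (k - l) ^ (-b)) := by
  have h : ‖k‖ ≤ ‖l‖ + ‖k - l‖ := by simpa using norm_add_le l (k - l)
  have he : Real.exp (-‖l‖ / 2 ^ n) * Real.exp (-‖k - l‖ / 2 ^ n) ≤ Real.exp (-‖k‖ / 2 ^ n) := by
    rw [← Real.exp_add, Real.exp_le_exp, ← add_div]
    gcongr
    linarith
  have hb' := bracket_rpow_mul_le hb k l
  calc expWeight b n l * expWeight b n (k - l)
      = (Real.exp (-‖l‖ / 2 ^ n) * Real.exp (-‖k - l‖ / 2 ^ n)) *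
        (bracket l ^ (-b) * bracket (k - l) ^ (-b)) := by unfold expWeight; ring
    _ ≤ Real.exp (-‖k‖ / 2 ^ n) * (2 ^ b * bracket k ^ (-b) *
        (bracket l ^ (-b) + bracket (k - l) ^ (-b))) := by
        refine mul_le_mul he hb' (mul_nonneg ?_ ?_) (Real.exp_pos _).le
        · exact Real.rpow_nonneg (bracket_pos _).le _
        · exact Real.rpow_nonneg (bracket_pos _).le _
    _ = _ := by unfold expWeight; ring

/-- The constant is uniform in n: the exponential factor is submultiplicative, so only the
polynomial factor contributes to it. -/
theorem exists_convWeight (d : ℕ) {b : ℝ} (hb : (d : ℝ) < b) :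
    ∃ C : ℝ, 1 ≤ C ∧ ∀ n, ConvWeight C (expWeight (d := d) b n) := by
  have hb0 : 0 ≤ b := (Nat.cast_nonneg d).trans hb.le
  have hs := summable_bracket_rpow hb
  have hs' : ∀ k : ZLat d, Summable fun l => bracket (k - l) ^ (-b) := fun k =>
    (Equiv.subLeft k).summable_iff.mpr hs
  have ht' : ∀ k : ZLat d, ∑' l, bracket (k - l) ^ (-b) = ∑' l : ZLat d, bracket l ^ (-b) :=
    fun k => (Equiv.subLeft k).tsum_eq fun l : ZLat d => bracket l ^ (-b)
  have hmaj : ∀ n (k : ZLat d), Summable fun l =>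
      2 ^ b * expWeight b n k * (bracket l ^ (-b) + bracket (k - l) ^ (-b)) := fun n k =>
    (hs.add (hs' k)).mul_left _
  have hsm : ∀ n (k : ZLat d), Summable fun l => expWeight b n l * expWeight b n (k - l) :=
    fun n k => Summable.of_nonneg_of_le
      (fun l => mul_nonneg (expWeight_nonneg _ _ _) (expWeight_nonneg _ _ _))
      (fun l => expWeight_mul_le hb0 n k l) (hmaj n k)
  refine ⟨max 1 (2 ^ b * (2 * ∑' l : ZLat d, bracket l ^ (-b))), le_max_left _ _, fun n =>
    ⟨expWeight_nonneg b n, ?_, hsm n, fun k => ?_⟩⟩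
  · exact Summable.of_nonneg_of_le (expWeight_nonneg b n) (expWeight_le_bracket b n) hs
  · calc ∑' l, expWeight b n l * expWeight b n (k - l)
        ≤ ∑' l, 2 ^ b * expWeight b n k * (bracket l ^ (-b) + bracket (k - l) ^ (-b)) :=
          (hsm n k).tsum_le_tsum (fun l => expWeight_mul_le hb0 n k l) (hmaj n k)
      _ = 2 ^ b * (2 * ∑' l : ZLat d, bracket l ^ (-b)) * expWeight b n k := by
          rw [tsum_mul_left, hs.tsum_add (hs' k), ht']; ring
      _ ≤ _ := mul_le_mul_of_nonneg_right (le_max_right _ _) (expWeight_nonneg _ _ _)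

/-- `t^τ ≤ C e^{t/2}` on the half line. -/
theorem exists_rpow_le_exp_half {τ : ℝ} (hτ : 0 ≤ τ) :
    ∃ C : ℝ, 1 ≤ C ∧ ∀ t : ℝ, 0 ≤ t → t ^ τ ≤ C * Real.exp (t / 2) := by
  obtain ⟨m, hm⟩ := exists_nat_ge τ
  refine ⟨max 1 (2 ^ m * m.factorial), le_max_left _ _, fun t ht => ?_⟩
  have he : 1 ≤ Real.exp (t / 2) := Real.one_le_exp (by linarith)
  rcases le_total t 1 with h | h
  · calc t ^ τ ≤ 1 := Real.rpow_le_one ht h hτ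
      _ ≤ 1 * Real.exp (t / 2) := by linarith
      _ ≤ _ := by gcongr; exact le_max_left _ _
  · have h1 := Real.pow_div_factorial_le_exp (t / 2) (by linarith) m
    rw [div_le_iff₀ (by positivity), div_pow, div_le_iff₀ (by positivity)] at h1
    calc t ^ τ ≤ t ^ (m : ℝ) := Real.rpow_le_rpow_of_exponent_le h hm
      _ = t ^ m := Real.rpow_natCast t m
      _ ≤ (2 ^ m * m.factorial) * Real.exp (t / 2) := by linarith
      _ ≤ _ := by gcongr; exact le_max_right _ _

/-- A loss of `|k|^τ` is compensated by passing to the next exponential weight. -/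
theorem norm_rpow_mul_expWeight_le {d : ℕ} {τ Cτ : ℝ} (b : ℝ)
    (hC : ∀ t : ℝ, 0 ≤ t → t ^ τ ≤ Cτ * Real.exp (t / 2)) (n : ℕ) (k : ZLat d) :
    ‖k‖ ^ τ * expWeight b n k ≤ Cτ * (2 ^ τ) ^ n * expWeight b (n + 1) k := by
  have h2 : (0 : ℝ) < 2 ^ n := by positivity
  have ht := hC (‖k‖ / 2 ^ n) (by positivity)
  rw [Real.div_rpow (norm_nonneg k) h2.le, div_le_iff₀ (Real.rpow_pos_of_pos h2 τ)] at ht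
  have e1 : ((2 : ℝ) ^ n) ^ τ = (2 ^ τ) ^ n := by
    rw [← Real.rpow_natCast, ← Real.rpow_natCast, ← Real.rpow_mul (by norm_num),
      ← Real.rpow_mul (by norm_num), mul_comm]
  have e2 : Real.exp (‖k‖ / 2 ^ n / 2) * Real.exp (-‖k‖ / 2 ^ n) =
      Real.exp (-‖k‖ / 2 ^ (n + 1)) := by
    rw [← Real.exp_add, pow_succ]; congr 1; field_simp; ring
  rw [e1] at ht
  unfold expWeight
  have hb : 0 ≤ bracket k ^ (-b) := Real.rpow_nonneg (bracket_pos k).le _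
  calc ‖k‖ ^ τ * (Real.exp (-‖k‖ / 2 ^ n) * bracket k ^ (-b))
      ≤ (Cτ * Real.exp (‖k‖ / 2 ^ n / 2) * (2 ^ τ) ^ n) *
        (Real.exp (-‖k‖ / 2 ^ n) * bracket k ^ (-b)) := by gcongr
    _ = Cτ * (2 ^ τ) ^ n * ((Real.exp (‖k‖ / 2 ^ n / 2) * Real.exp (-‖k‖ / 2 ^ n)) *
        bracket k ^ (-b)) := by ring
    _ = _ := by rw [e2]

/-! ### Algebra of infinite matrices under a weight. -/

/-- The matrix `X` is bounded by `c u (i - j)`. -/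
def MatBound {d : ℕ} (u : ZLat d → ℝ) (c : ℝ) (X : ZLat d → ZLat d → ℂ) : Prop :=
  ∀ i j, ‖X i j‖ ≤ c * u (i - j)

/-- The product of infinite matrices. -/
def matMul {d : ℕ} (X Y : ZLat d → ZLat d → ℂ) (i j : ZLat d) : ℂ := ∑' l, X i l * Y l j

namespace ConvWeight

variable {d : ℕ} {C : ℝ} {u : ZLat d → ℝ}

theorem summable_mul' (hu : ConvWeight C u) (i j : ZLat d) :
    Summable fun l => u (i - l) * u (l - j) := by
  have := (Equiv.subLeft i).summable_iff.mpr (hu.summable_mul (i - j))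
  refine this.congr fun l => ?_
  simp [Equiv.subLeft]

theorem tsum_mul_le' (hu : ConvWeight C u) (i j : ZLat d) :
    ∑' l, u (i - l) * u (l - j) ≤ C * u (i - j) := by
  rw [← (Equiv.subLeft i).tsum_eq]
  refine le_of_eq_of_le (tsum_congr fun l => ?_) (hu.tsum_le (i - j))
  simp [Equiv.subLeft, sub_right_comm]

theorem summable_norm_matMul (hu : ConvWeight C u) {X Y : ZLat d → ZLat d → ℂ} {x y : ℝ}
    (hX : MatBound u x X) (hY : MatBound u y Y) (i j : ZLat d) :
    Summable fun l => ‖X i l * Y l j‖ := by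
  refine Summable.of_nonneg_of_le (fun _ => norm_nonneg _) (fun l => ?_)
    ((hu.summable_mul' i j).mul_left (x * y))
  rw [norm_mul]
  calc ‖X i l‖ * ‖Y l j‖ ≤ (x * u (i - l)) * (y * u (l - j)) :=
        mul_le_mul (hX i l) (hY l j) (norm_nonneg _) ((norm_nonneg _).trans (hX i l))
    _ = _ := by ring

theorem summable_matMul (hu : ConvWeight C u) {X Y : ZLat d → ZLat d → ℂ} {x y : ℝ}
    (hX : MatBound u x X) (hY : MatBound u y Y) (i j : ZLat d) :
    Summable fun l => X i l * Y l j :=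
  (hu.summable_norm_matMul hX hY i j).of_norm

theorem tsum_norm_matMul_le (hu : ConvWeight C u) {X Y : ZLat d → ZLat d → ℂ} {x y : ℝ}
    (hx : 0 ≤ x) (hy : 0 ≤ y)
    (hX : MatBound u x X) (hY : MatBound u y Y) (i j : ZLat d) :
    ∑' l, ‖X i l * Y l j‖ ≤ x * y * C * u (i - j) := by
  calc ∑' l, ‖X i l * Y l j‖ ≤ ∑' l, (x * y) * (u (i - l) * u (l - j)) := by
        refine (hu.summable_norm_matMul hX hY i j).tsum_le_tsum (fun l => ?_)
          ((hu.summable_mul' i j).mul_left (x * y))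
        rw [norm_mul]
        calc ‖X i l‖ * ‖Y l j‖ ≤ (x * u (i - l)) * (y * u (l - j)) :=
              mul_le_mul (hX i l) (hY l j) (norm_nonneg _) ((norm_nonneg _).trans (hX i l))
          _ = _ := by ring
    _ ≤ (x * y) * (C * u (i - j)) := by
        rw [tsum_mul_left]
        exact mul_le_mul_of_nonneg_left (hu.tsum_mul_le' i j) (mul_nonneg hx hy)
    _ = _ := by ring

theorem matBound_matMul (hu : ConvWeight C u) {X Y : ZLat d → ZLat d → ℂ} {x y : ℝ}
    (hx : 0 ≤ x) (hy : 0 ≤ y) (hX : MatBound u x X) (hY : MatBound u y Y) :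
    MatBound u (x * y * C) (matMul X Y) := fun i j =>
  (norm_tsum_le_tsum_norm (hu.summable_norm_matMul hX hY i j)).trans
    (hu.tsum_norm_matMul_le hx hy hX hY i j)

theorem matMul_assoc (hu : ConvWeight C u) {X Y Z : ZLat d → ZLat d → ℂ} {x y z : ℝ}
    (hy : 0 ≤ y) (hz : 0 ≤ z)
    (hX : MatBound u x X) (hY : MatBound u y Y) (hZ : MatBound u z Z) :
    matMul (matMul X Y) Z = matMul X (matMul Y Z) := by
  funext i j
  have hsum : Summable (Function.uncurry fun m l => X i m * (Y m l * Z l j)) := by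
    refine Summable.of_norm ((summable_prod_of_nonneg fun _ => norm_nonneg _).mpr ⟨fun m => ?_, ?_⟩)
    · simp only [Function.uncurry, norm_mul (X i m)]
      exact (hu.summable_norm_matMul hY hZ m j).mul_left _
    · simp only [Function.uncurry, norm_mul (X i _)]
      refine Summable.of_nonneg_of_le (fun m => tsum_nonneg fun _ => by positivity) (fun m => ?_)
        ((hu.summable_mul' i j).mul_left (x * (y * z * C)))
      rw [tsum_mul_left]
      calc ‖X i m‖ * ∑' l, ‖Y m l * Z l j‖ ≤ (x * u (i - m)) * (y * z * C * u (m - j)) :=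
            mul_le_mul (hX i m) (hu.tsum_norm_matMul_le hy hz hY hZ m j)
              (tsum_nonneg fun _ => norm_nonneg _) ((norm_nonneg _).trans (hX i m))
        _ = _ := by ring
  calc ∑' l, (∑' m, X i m * Y m l) * Z l j = ∑' l, ∑' m, X i m * (Y m l * Z l j) := by
        refine tsum_congr fun l => ?_
        rw [← tsum_mul_right]
        exact tsum_congr fun m => mul_assoc _ _ _
    _ = ∑' m, ∑' l, X i m * (Y m l * Z l j) := hsum.tsum_comm
    _ = _ := tsum_congr fun m => tsum_mul_left

end ConvWeight

/-! ### The defect and its change in one step. -/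

/-- The defect of `(D + T)(1 + Y) = (1 + Y)(D + g)`. -/
def defect {d : ℕ} (D g : ZLat d → ℂ) (T Y : ZLat d → ZLat d → ℂ) (i j : ZLat d) : ℂ :=
  (D i - D j) * Y i j + T i j + matMul T Y i j - ((if i = j then 1 else 0) + Y i j) * g j

/-- One diagonalization step: the new defect in terms of the old one. -/
theorem defect_step {d : ℕ} {C : ℝ} {u : ZLat d → ℝ} (hu : ConvWeight C u)
    {D g : ZLat d → ℂ} {T T' Y W F : ZLat d → ZLat d → ℂ} {t t' y w e : ℝ}
    (ht : 0 ≤ t) (hy : 0 ≤ y) (hw : 0 ≤ w)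
    (hT : MatBound u t T) (hT' : MatBound u t' T') (hY : MatBound u y Y) (hW : MatBound u w W)
    (hF : MatBound u e F)
    (hdef : defect D g T Y = F) (hW0 : ∀ i, W i i = 0)
    (hWF : ∀ i j, i ≠ j → (D i + g i - (D j + g j)) * W i j = -F i j) :
    defect D (fun j => g j + F j j) (T + T') (Y + (W + matMul Y W)) =
      fun i j => -matMul Y F i j + matMul F W i j - (W + matMul Y W) i j * F j j +
        T' i j + matMul T' (Y + (W + matMul Y W)) i j := by
  have hYW := hu.matBound_matMul hy hw hY hW
  have hadd : ∀ {X Z : ZLat d → ZLat d → ℂ} {x z : ℝ}, MatBound u x X → MatBound u z Z →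
      MatBound u (x + z) (X + Z) := fun hX hZ i j =>
    (norm_add_le _ _).trans (by rw [add_mul]; exact add_le_add (hX i j) (hZ i j))
  have hZ := hadd hW hYW
  have hY' := hadd hY hZ
  have hassoc := hu.matMul_assoc hy hw hT hY hW
  funext i j
  -- The homological equation including its diagonal entry. It trades the possibly unbounded D_l for
  -- terms with absolutely convergent sums.
  have hWF' : ∀ l, (D l + g l) * W l j = -F l j + (if l = j then F j j else 0)
      + (D j + g j) * W l j := by
    intro l
    by_cases h : l = j
    · subst h; simp [hW0]
    · have := hWF l j h
      simp only [h, if_false]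
      linear_combination this
  -- Expands FW with F = (D + T)(1 + Y) - (1 + Y)(D + g). The series of Y_il D_l W_lj is never
  -- summed by itself; `hWF'` removes D_l first.
  have hFW : HasSum (fun l => F i l * W l j)
      ((D i - (D j + g j)) * matMul Y W i j + matMul Y F i j - Y i j * F j j
        + matMul T W i j + matMul (matMul T Y) W i j - g i * W i j) := by
    have h1 := (hu.summable_matMul hY hW i j).hasSum.mul_left (D i - (D j + g j))
    have h2 := (hu.summable_matMul hY hF i j).hasSum
    have h3 : HasSum (fun l => if l = j then Y i j * F j j else 0) (Y i j * F j j) :=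
      hasSum_ite_eq j _
    have h4 := (hu.summable_matMul hT hW i j).hasSum
    have h5 := (hu.summable_matMul (hu.matBound_matMul ht hy hT hY) hW i j).hasSum
    have h6 : HasSum (fun l => if l = i then g i * W i j else 0) (g i * W i j) :=
      hasSum_ite_eq i _
    refine (((((h1.add h2).sub h3).add h4).add h5).sub h6).congr_fun fun l => ?_
    have eF : F i l = (D i - D l) * Y i l + T i l + matMul T Y i l -
        ((if i = l then 1 else 0) + Y i l) * g l := by rw [← hdef]; rfl
    have e1 : (if l = j then Y i j * F j j else 0) = Y i l * (if l = j then F j j else 0) := by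
      by_cases h : l = j
      · subst h; simp
      · simp [h]
    have e2 : (if l = i then g i * W i j else 0) = (if i = l then 1 else 0) * g l * W l j := by
      by_cases h : i = l
      · subst h; simp
      · simp [h, Ne.symm h]
    rw [e1, e2]
    linear_combination W l j * eF - Y i l * hWF' l
  have e1 : matMul (T + T') (Y + (W + matMul Y W)) i j =
      matMul T Y i j + (matMul T W i j + matMul T (matMul Y W) i j) +
        matMul T' (Y + (W + matMul Y W)) i j := by
    have h1 := (hu.summable_matMul hT hY i j).hasSum
    have h2 := (hu.summable_matMul hT hW i j).hasSum
    have h3 := (hu.summable_matMul hT hYW i j).hasSum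
    have h4 := (hu.summable_matMul hT' hY' i j).hasSum
    refine HasSum.tsum_eq (((h1.add (h2.add h3)).add h4).congr_fun fun l => ?_)
    simp only [Pi.add_apply]
    ring
  have e2 : matMul F W i j = _ := hFW.tsum_eq
  have e3 := congrFun (congrFun hdef i) j
  have e4 := hWF' i
  simp only [defect] at e3 ⊢
  rw [e1, e2, ← hassoc]
  simp only [Pi.add_apply] at e3 ⊢
  by_cases h : i = j
  · subst h
    simp only [if_true] at *
    linear_combination e3 + e4
  · simp only [h, if_false] at *
    linear_combination e3 + e4

/-! ### Periodic holomorphic functions on strips. -/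

theorem isOpen_strip (r : ℝ) : IsOpen (strip r) :=
  isOpen_lt (continuous_abs.comp Complex.continuous_im) continuous_const

theorem strip_mono {r r' : ℝ} (h : r' ≤ r) : strip r' ⊆ strip r := fun _ hz => lt_of_lt_of_le hz h

theorem sub_ofReal_mem_strip {r : ℝ} {z : ℂ} (hz : z ∈ strip r) (x : ℝ) : z - x ∈ strip r := by
  simpa [strip] using hz

theorem add_intCast_mem_strip {r : ℝ} {z : ℂ} (hz : z ∈ strip r) (n : ℤ) :
    z + n ∈ strip r := by
  simpa [strip] using hz

theorem ofReal_mem_strip {r : ℝ} (hr : 0 < r) (x : ℝ) : (x : ℂ) ∈ strip r := by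
  simpa [strip] using hr

theorem convex_strip (r : ℝ) : Convex ℝ (strip r) := by
  have : strip r = Complex.imLm ⁻¹' Metric.ball 0 r := by
    ext z; simp [strip, Complex.imLm]
  rw [this]
  exact (convex_ball 0 r).linear_preimage _

/-- A function that is holomorphic and `1`-periodic on the strip. -/
structure PeriodicHol (r : ℝ) (g : ℂ → ℂ) : Prop where
  diff : DifferentiableOn ℂ g (strip r)
  per : ∀ z ∈ strip r, ∀ n : ℤ, g (z + n) = g z

namespace PeriodicHol

variable {r : ℝ} {g g' : ℂ → ℂ}

theorem mono {r' : ℝ} (hg : PeriodicHol r g) (h : r' ≤ r) : PeriodicHol r' g :=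
  ⟨hg.diff.mono (strip_mono h), fun z hz => hg.per z (strip_mono h hz)⟩

theorem const (c : ℂ) : PeriodicHol r fun _ => c :=
  ⟨differentiableOn_const _, fun _ _ _ => rfl⟩

theorem add (hg : PeriodicHol r g) (hg' : PeriodicHol r g') :
    PeriodicHol r fun z => g z + g' z :=
  ⟨hg.diff.add hg'.diff, fun z hz n => by simp only [hg.per z hz, hg'.per z hz]⟩

theorem neg (hg : PeriodicHol r g) : PeriodicHol r fun z => -g z :=
  ⟨hg.diff.neg, fun z hz n => by simp only [hg.per z hz]⟩

theorem mul (hg : PeriodicHol r g) (hg' : PeriodicHol r g') :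
    PeriodicHol r fun z => g z * g' z :=
  ⟨hg.diff.mul hg'.diff, fun z hz n => by simp only [hg.per z hz, hg'.per z hz]⟩

theorem sub (hg : PeriodicHol r g) (hg' : PeriodicHol r g') :
    PeriodicHol r fun z => g z - g' z :=
  ⟨hg.diff.sub hg'.diff, fun z hz n => by simp only [hg.per z hz, hg'.per z hz]⟩

theorem div (hg : PeriodicHol r g) (hg' : PeriodicHol r g') (h0 : ∀ z ∈ strip r, g' z ≠ 0) :
    PeriodicHol r fun z => g z / g' z :=
  ⟨hg.diff.div hg'.diff h0, fun z hz n => by simp only [hg.per z hz, hg'.per z hz]⟩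

theorem shift (hg : PeriodicHol r g) (x : ℝ) : PeriodicHol r fun z => g (z - x) where
  diff := hg.diff.comp (differentiableOn_id.sub_const _) fun _ hz => sub_ofReal_mem_strip hz x
  per z hz n := by
    rw [add_sub_right_comm]
    exact hg.per _ (sub_ofReal_mem_strip hz x) n

/-- Cauchy's estimate: a bounded periodic function is Lipschitz along the reals, with respect to
the distance on `ℝ/ℤ`, on a smaller strip. -/
theorem norm_sub_shift_le (hg : PeriodicHol r g) {r' ε : ℝ} (hr : r' < r)
    (hb : ∀ z ∈ strip r, ‖g z‖ ≤ ε) {z : ℂ} (hz : z ∈ strip r') (x : ℝ) :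
    ‖g z - g (z - x)‖ ≤ ε / (r - r') * ‖(x : UnitAddCircle)‖ := by
  have hR : 0 < r - r' := sub_pos.mpr hr
  have hsub := strip_mono hr.le
  have hderiv : ∀ w ∈ strip r', ‖deriv g w‖ ≤ ε / (r - r') := by
    intro w hw
    have hball : Metric.closedBall w (r - r') ⊆ strip r := by
      intro v hv
      have h1 : |(v - w).im| ≤ r - r' := by
        rw [Metric.mem_closedBall, dist_eq_norm] at hv
        exact (Complex.abs_im_le_norm _).trans hv
      have h2 : |w.im| < r' := hw
      have h3 : |v.im| ≤ |(v - w).im| + |w.im| := by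
        have := abs_add_le (v - w).im w.im
        simpa using this
      change |v.im| < r
      linarith
    refine Complex.norm_deriv_le_of_forall_mem_sphere_norm_le hR ?_ fun v hv =>
      hb v (hball (Metric.sphere_subset_closedBall hv))
    refine DifferentiableOn.diffContOnCl (hg.diff.mono ?_)
    rwa [closure_ball _ hR.ne']
  -- By periodicity x may be replaced by its representative nearest to 0, so the mean value segment
  -- has length ‖x‖ in ℝ/ℤ.
  set y : ℝ := x - round x with hy
  have hxy : z - x = z - y + ((-round x : ℤ) : ℂ) := by
    rw [hy]; push_cast; ring
  have hzy : z - y ∈ strip r' := sub_ofReal_mem_strip hz y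
  rw [hxy, hg.per _ (hsub hzy)]
  have hmv := (convex_strip r').norm_image_sub_le_of_norm_deriv_le
    (fun w hw => hg.diff.differentiableAt ((isOpen_strip r).mem_nhds (hsub hw))) hderiv hzy hz
  refine hmv.trans (le_of_eq ?_)
  congr 1
  rw [sub_sub_cancel, Complex.norm_real, UnitAddCircle.norm_eq, Real.norm_eq_abs]

end PeriodicHol

/-! ### Covariant matrices and their symbols. -/

/-- A family of holomorphic periodic functions on the strip with majorant `ε u`. -/
structure HolFam {d : ℕ} (r : ℝ) (u : ZLat d → ℝ) (ε : ℝ) (A : ZLat d → ℂ → ℂ) : Prop where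
  hol : ∀ k, PeriodicHol r (A k)
  bound : ∀ k, ∀ z ∈ strip r, ‖A k z‖ ≤ ε * u k

/-- The symbol of the product of two covariant matrices. -/
def symMul {d : ℕ} (ω : Fin d → ℝ) (A B : ZLat d → ℂ → ℂ) (k : ZLat d) (z : ℂ) : ℂ :=
  ∑' l, A l z * B (k - l) (z - latDot l ω)

/-- The covariant matrix with symbol `A`, at the base point `0`. -/
def orbitMat {d : ℕ} (ω : Fin d → ℝ) (A : ZLat d → ℂ → ℂ) (i j : ZLat d) : ℂ :=
  A (i - j) (latDot i ω)

theorem latDot_sub {d : ℕ} (i j : ZLat d) (ω : Fin d → ℝ) :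
    latDot (i - j) ω = latDot i ω - latDot j ω := by
  simp [latDot, sub_mul]

/-- The substitution l ↦ i - l works because i·ω - (i-l)·ω = l·ω. Matrix identities on the orbit of
0 thus reflect operations on symbols. -/
theorem orbitMat_symMul {d : ℕ} (ω : Fin d → ℝ) (A B : ZLat d → ℂ → ℂ) :
    orbitMat ω (symMul ω A B) = matMul (orbitMat ω A) (orbitMat ω B) := by
  funext i j
  unfold orbitMat symMul matMul
  rw [← (Equiv.subLeft i).tsum_eq]
  refine tsum_congr fun l => ?_
  simp only [Equiv.subLeft_apply, latDot_sub]
  congr 2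
  · abel
  · push_cast; ring

namespace HolFam

variable {d : ℕ} {r C α β : ℝ} {u v : ZLat d → ℝ} {ω : Fin d → ℝ} {A B : ZLat d → ℂ → ℂ}

theorem mono (hA : HolFam r u α A) {r' β : ℝ} (hr : r' ≤ r) (h : ∀ k, α * u k ≤ β * v k) :
    HolFam r' v β A :=
  ⟨fun k => (hA.hol k).mono hr, fun k z hz => (hA.bound k z (strip_mono hr hz)).trans (h k)⟩

theorem zero : HolFam r u 0 (0 : ZLat d → ℂ → ℂ) :=
  ⟨fun _ => PeriodicHol.const 0, fun k z _ => by simp⟩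

theorem neg (hA : HolFam r u α A) : HolFam r u α (-A) :=
  ⟨fun k => (hA.hol k).neg, fun k z hz => by simpa using hA.bound k z hz⟩

theorem add (hA : HolFam r u α A) (hB : HolFam r u β B) : HolFam r u (α + β) (A + B) :=
  ⟨fun k => (hA.hol k).add (hB.hol k), fun k z hz =>
    (norm_add_le _ _).trans (by rw [add_mul]; exact add_le_add (hA.bound k z hz) (hB.bound k z hz))⟩

theorem matBound (hA : HolFam r u α A) (hr : 0 < r) : MatBound u α (orbitMat ω A) :=
  fun _ _ => hA.bound _ _ (ofReal_mem_strip hr _)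

theorem symMul (hA : HolFam r u α A) (hB : HolFam r u β B) (hu : ConvWeight C u)
    (hα : 0 ≤ α) (hβ : 0 ≤ β) : HolFam r u (α * β * C) (symMul ω A B) := by
  have hb : ∀ k l z, z ∈ strip r →
      ‖A l z * B (k - l) (z - latDot l ω)‖ ≤ α * β * (u l * u (k - l)) := by
    intro k l z hz
    have h1 := hA.bound l z hz
    have h2 := hB.bound (k - l) _ (sub_ofReal_mem_strip hz (latDot l ω))
    rw [norm_mul]
    calc _ ≤ (α * u l) * (β * u (k - l)) :=
          mul_le_mul h1 h2 (norm_nonneg _) ((norm_nonneg _).trans h1)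
      _ = _ := by ring
  have hs : ∀ k, Summable fun l => α * β * (u l * u (k - l)) := fun k =>
    (hu.summable_mul k).mul_left _
  refine ⟨fun k => ⟨?_, fun z hz n => ?_⟩, fun k z hz => ?_⟩
  · exact Complex.differentiableOn_tsum_of_summable_norm (hs k)
      (fun l => ((hA.hol l).mul ((hB.hol (k - l)).shift (latDot l ω))).diff) (isOpen_strip r)
      (fun l z hz => hb k l z hz)
  · exact tsum_congr fun l => ((hA.hol l).mul ((hB.hol (k - l)).shift (latDot l ω))).per z hz n
  · refine (tsum_of_norm_bounded (hs k).hasSum fun l => hb k l z hz).trans ?_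
    rw [tsum_mul_left, mul_assoc (α * β)]
    exact mul_le_mul_of_nonneg_left (hu.tsum_le k) (mul_nonneg hα hβ)

/-- Multiplication of a covariant matrix by a bounded diagonal matrix from the right. -/
theorem mul_diag (hA : HolFam r u α A) {g : ℂ → ℂ} (hg : PeriodicHol r g)
    (hb : ∀ z ∈ strip r, ‖g z‖ ≤ β) :
    HolFam r u (α * β) fun k z => A k z * g (z - latDot k ω) := by
  refine ⟨fun k => (hA.hol k).mul (hg.shift _), fun k z hz => ?_⟩
  rw [norm_mul]
  calc _ ≤ (α * u k) * β := mul_le_mul (hA.bound k z hz) (hb _ (sub_ofReal_mem_strip hz _))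
        (norm_nonneg _) ((norm_nonneg _).trans (hA.bound k z hz))
    _ = _ := by ring

end HolFam

/-! ### Small divisors and the homological equation. -/

/-- Holomorphic extensions `h_k(z)` of the inverse divisors `1 / (f(z) - f(z - k·ω))`, where
`D i = f(i·ω)`. -/
structure DivisorInverse {d : ℕ} (r c : ℝ) (ω : Fin d → ℝ) (D : ZLat d → ℂ)
    (h : ZLat d → ℂ → ℂ) : Prop where
  hol : ∀ k, k ≠ 0 → PeriodicHol r (h k)
  bound : ∀ k, k ≠ 0 → ∀ z ∈ strip r, c * ‖(latDot k ω : UnitAddCircle)‖ * ‖h k z‖ ≤ 1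
  mul_eq_one : ∀ i j, i ≠ j → (D i - D j) * h (i - j) (latDot i ω) = 1

/-- The solution `W` of `[D + g, W] = -(F - diag F)`. -/
def homologicalSol {d : ℕ} (ω : Fin d → ℝ) (h F : ZLat d → ℂ → ℂ) (g : ℂ → ℂ) (k : ZLat d)
    (z : ℂ) : ℂ :=
  if k = 0 then 0 else -(F k z * h k z) / (1 + h k z * (g z - g (z - latDot k ω)))

/-- `g` is `η`-Lipschitz along the reals for the distance on `ℝ/ℤ`. -/
def RealLip (r η : ℝ) (g : ℂ → ℂ) : Prop :=
  ∀ z ∈ strip r, ∀ x : ℝ, ‖g z - g (z - x)‖ ≤ η * ‖(x : UnitAddCircle)‖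

theorem DivisorInverse.mono {d : ℕ} {r r' c : ℝ} {ω : Fin d → ℝ} {D : ZLat d → ℂ}
    {h : ZLat d → ℂ → ℂ} (hh : DivisorInverse r c ω D h) (hr : r' ≤ r) :
    DivisorInverse r' c ω D h :=
  ⟨fun k hk => (hh.hol k hk).mono hr, fun k hk z hz => hh.bound k hk z (strip_mono hr hz),
    hh.mul_eq_one⟩

section Homological

variable {d : ℕ} {r c η ε τ γ Cτ b : ℝ} {ω : Fin d → ℝ} {D : ZLat d → ℂ} {h F : ZLat d → ℂ → ℂ}
  {g : ℂ → ℂ}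

/-- The divisor of f + g is that of f times this expression. Both |f(z) - f(z-x)|/c and the
Lipschitz bound for g scale with ‖x‖, so the perturbation is at most 1/2 uniformly in k. -/
theorem DivisorInverse.half_le (hh : DivisorInverse r c ω D h) (hg : RealLip r η g)
    (hη : η ≤ c / 2) {k : ZLat d} (hk : k ≠ 0) {z : ℂ} (hz : z ∈ strip r) :
    1 / 2 ≤ ‖1 + h k z * (g z - g (z - latDot k ω))‖ := by
  have h1 := hh.bound k hk z hz
  have h2 := hg z hz (latDot k ω)
  have h3 : ‖h k z * (g z - g (z - latDot k ω))‖ ≤ 1 / 2 := by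
    rw [norm_mul]
    calc _ ≤ ‖h k z‖ * (c / 2 * ‖(latDot k ω : UnitAddCircle)‖) := by
          gcongr; exact h2.trans (by gcongr)
      _ = 1 / 2 * (c * ‖(latDot k ω : UnitAddCircle)‖ * ‖h k z‖) := by ring
      _ ≤ 1 / 2 * 1 := by gcongr
      _ = 1 / 2 := by ring
  have h4 := norm_sub_le (1 + h k z * (g z - g (z - latDot k ω)))
    (h k z * (g z - g (z - latDot k ω)))
  rw [add_sub_cancel_right, norm_one] at h4
  linarith

theorem homologicalSol_eq (hr : 0 < r) (hh : DivisorInverse r c ω D h) (hg : RealLip r η g)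
    (hη : η ≤ c / 2) {i j : ZLat d} (hij : i ≠ j) :
    (D i + g (latDot i ω) - (D j + g (latDot j ω))) *
      orbitMat ω (homologicalSol ω h F g) i j = -orbitMat ω F i j := by
  have hk : i - j ≠ 0 := sub_ne_zero.mpr hij
  have h0 := hh.half_le hg hη hk (ofReal_mem_strip hr (latDot i ω))
  have h1 := hh.mul_eq_one i j hij
  have e : (latDot i ω : ℂ) - (latDot (i - j) ω : ℝ) = latDot j ω := by
    rw [latDot_sub]; push_cast; ring
  rw [e] at h0
  have h0' : 1 + h (i - j) (latDot i ω) * (g (latDot i ω) - g (latDot j ω)) ≠ 0 := by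
    intro h; rw [h, norm_zero] at h0; norm_num at h0
  simp only [orbitMat, homologicalSol, hk, if_false, e]
  rw [mul_div_assoc', div_eq_iff h0']
  linear_combination (-F (i - j) (latDot i ω)) * h1

/-- In the constant, 2 comes from the lower bound 1/2 on the denominator, 1/(cγ) from the
Diophantine divisor bound, and Cτ (2^τ)^n from absorbing |k|^τ into the next weight. -/
theorem holFam_homologicalSol (hc : 0 < c) (hγ : 0 < γ) (hε : 0 ≤ ε)
    (hω : Diophantine τ γ ω) (hh : DivisorInverse r c ω D h) (hg : RealLip r η g)
    (hg' : PeriodicHol r g) (hη : η ≤ c / 2)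
    (hC : ∀ t : ℝ, 0 ≤ t → t ^ τ ≤ Cτ * Real.exp (t / 2)) (hC1 : 1 ≤ Cτ) {n : ℕ}
    (hF : HolFam r (expWeight b n) ε F) :
    HolFam r (expWeight b (n + 1)) (2 * Cτ / (c * γ) * (2 ^ τ) ^ n * ε)
      (homologicalSol ω h F g) := by
  have hne : ∀ k : ZLat d, k ≠ 0 → ∀ z ∈ strip r,
      1 + h k z * (g z - g (z - latDot k ω)) ≠ 0 := by
    intro k hk z hz h0
    have := hh.half_le hg hη hk hz
    rw [h0, norm_zero] at this; norm_num at this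
  refine ⟨fun k => ?_, fun k z hz => ?_⟩
  · by_cases hk : k = 0
    · have : homologicalSol ω h F g k = fun _ => 0 := by funext z; simp [homologicalSol, hk]
      rw [this]; exact PeriodicHol.const 0
    · have : homologicalSol ω h F g k = fun z =>
          -(F k z * h k z) / (1 + h k z * (g z - g (z - latDot k ω))) := by
        funext z; simp [homologicalSol, hk]
      rw [this]
      exact ((hF.hol k).mul (hh.hol k hk)).neg.div ((PeriodicHol.const 1).add
        ((hh.hol k hk).mul (hg'.sub (hg'.shift _)))) (hne k hk)
  · have hu := expWeight_nonneg b (n + 1) k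
    by_cases hk : k = 0
    · simp only [homologicalSol, hk, if_true, norm_zero]
      have := expWeight_nonneg b (n + 1) (0 : ZLat d)
      positivity
    · have hk1 : 0 < ‖k‖ := one_pos.trans_le (one_le_norm_of_ne_zero hk)
      have hkτ : 0 < ‖k‖ ^ τ := Real.rpow_pos_of_pos hk1 _
      have h1 := hh.half_le hg hη hk hz
      have h2 : ‖h k z‖ ≤ ‖k‖ ^ τ / (c * γ) := by
        have hb := hh.bound k hk z hz
        have hd := hω k hk
        rw [le_div_iff₀ (by positivity)]
        have h3 : c * (γ / ‖k‖ ^ τ) * ‖h k z‖ ≤ 1 := le_trans (by gcongr) hb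
        have h4 : c * (γ / ‖k‖ ^ τ) * ‖h k z‖ = ‖h k z‖ * (c * γ) / ‖k‖ ^ τ := by ring
        rw [h4, div_le_one hkτ] at h3
        exact h3
      have h5 := hF.bound k z hz
      have h6 := norm_rpow_mul_expWeight_le b hC n k
      have hun := expWeight_nonneg b n k
      simp only [homologicalSol, hk, if_false, norm_div, norm_neg, norm_mul]
      rw [div_le_iff₀ (by linarith)]
      calc ‖F k z‖ * ‖h k z‖ ≤ (ε * expWeight b n k) * (‖k‖ ^ τ / (c * γ)) := by gcongr
        _ = ε / (c * γ) * (‖k‖ ^ τ * expWeight b n k) := by ring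
        _ ≤ ε / (c * γ) * (Cτ * (2 ^ τ) ^ n * expWeight b (n + 1) k) := by gcongr
        _ = (2 * Cτ / (c * γ) * (2 ^ τ) ^ n * ε * expWeight b (n + 1) k) * (1 / 2) := by ring
        _ ≤ _ := by gcongr

end Homological

/-! ### Truncation of the hopping. -/

/-- The hopping symbol cut off at range `2^n`. -/
def truncSymbol {d : ℕ} (φ : ZLat d → ℝ) (n : ℕ) (k : ZLat d) (_ : ℂ) : ℂ :=
  if ‖k‖ ≤ 2 ^ n then (φ k : ℂ) else 0

section Trunc

variable {d : ℕ} {a b κ : ℝ} {φ : ZLat d → ℝ}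

theorem truncSymbol_norm_le (n : ℕ) (k : ZLat d) (z : ℂ) : ‖truncSymbol φ n k z‖ ≤ |φ k| := by
  unfold truncSymbol
  split_ifs <;> simp

/-- Within range 2^n the exponential factor is at least 1/e. -/
theorem bracket_rpow_le_exp_mul_expWeight {n : ℕ} {k : ZLat d} (hk : ‖k‖ ≤ 2 ^ n) :
    bracket k ^ (-b) ≤ Real.exp 1 * expWeight b n k := by
  have h1 : ‖k‖ / 2 ^ n ≤ 1 := (div_le_one (by positivity)).mpr hk
  have h2 : 1 ≤ Real.exp 1 * Real.exp (-‖k‖ / 2 ^ n) := by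
    rw [← Real.exp_add]
    exact Real.one_le_exp (by rw [neg_div]; linarith)
  unfold expWeight
  rw [← mul_assoc]
  exact le_mul_of_one_le_left (Real.rpow_nonneg (bracket_pos k).le _) h2

theorem holFam_truncSymbol_zero (r : ℝ) (hκ : 0 ≤ κ) (ha : 0 ≤ a)
    (hφ : ∀ k, |φ k| ≤ κ * bracket k ^ (-(a + b))) :
    HolFam r (expWeight b 0) (Real.exp 1 * κ) (truncSymbol φ 0) := by
  refine ⟨fun k => PeriodicHol.const _, fun k z _ => ?_⟩
  have hu := expWeight_nonneg b 0 k
  unfold truncSymbol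
  split_ifs with h
  · have h1 := bracket_rpow_le_exp_mul_expWeight (b := b) h
    have h2 : bracket k ^ (-(a + b)) ≤ bracket k ^ (-b) :=
      Real.rpow_le_rpow_of_exponent_le (one_le_bracket k) (by linarith)
    rw [Complex.norm_real, Real.norm_eq_abs]
    calc |φ k| ≤ κ * bracket k ^ (-(a + b)) := hφ k
      _ ≤ κ * (Real.exp 1 * expWeight b 0 k) := by gcongr; exact h2.trans h1
      _ = _ := by ring
  · rw [norm_zero]; positivity

/-- Only the shell 2^n < |k| ≤ 2^(n+1) survives. There ⟨k⟩^{-a} ≤ 2^{-an}, and the other power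
⟨k⟩^{-b} is at most e times the weight. -/
theorem holFam_truncSymbol_sub (r : ℝ) (hκ : 0 ≤ κ) (ha : 0 ≤ a)
    (hφ : ∀ k, |φ k| ≤ κ * bracket k ^ (-(a + b))) (n : ℕ) :
    HolFam r (expWeight b (n + 1)) (Real.exp 1 * κ * (2 ^ (-a)) ^ n)
      (truncSymbol φ (n + 1) - truncSymbol φ n) := by
  refine ⟨fun k => PeriodicHol.const
    ((if ‖k‖ ≤ 2 ^ (n + 1) then (φ k : ℂ) else 0) - if ‖k‖ ≤ 2 ^ n then (φ k : ℂ) else 0),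
    fun k z _ => ?_⟩
  have hu := expWeight_nonneg b (n + 1) k
  have hA : (0 : ℝ) ≤ 2 ^ (-a) := Real.rpow_nonneg (by norm_num) _
  simp only [Pi.sub_apply, truncSymbol]
  have hmono : (2 : ℝ) ^ n ≤ 2 ^ (n + 1) := by gcongr <;> norm_num
  by_cases h1 : ‖k‖ ≤ 2 ^ n
  · simp only [h1, h1.trans hmono, if_true, sub_self, norm_zero]; positivity
  · by_cases h2 : ‖k‖ ≤ 2 ^ (n + 1)
    · simp only [h1, h2, if_true, if_false, sub_zero, Complex.norm_real, Real.norm_eq_abs]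
      have h3 := bracket_rpow_le_exp_mul_expWeight (b := b) h2
      have h4 : (2 : ℝ) ^ n ≤ bracket k := (not_le.mp h1).le.trans (le_max_right _ _)
      have h5 : bracket k ^ (-a) ≤ (2 ^ (-a)) ^ n := by
        refine (Real.rpow_le_rpow_of_nonpos (by positivity) h4 (by linarith)).trans (le_of_eq ?_)
        rw [← Real.rpow_natCast, ← Real.rpow_natCast, ← Real.rpow_mul (by norm_num),
          ← Real.rpow_mul (by norm_num), mul_comm]
      calc |φ k| ≤ κ * bracket k ^ (-(a + b)) := hφ k
        _ = κ * (bracket k ^ (-a) * bracket k ^ (-b)) := by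
            rw [← Real.rpow_add (bracket_pos k)]; congr 2; ring
        _ ≤ κ * ((2 ^ (-a)) ^ n * (Real.exp 1 * expWeight b (n + 1) k)) := by
            have := Real.rpow_nonneg (bracket_pos k).le (-b)
            gcongr
        _ = _ := by ring
    · simp only [h1, h2, if_false, sub_zero, norm_zero]; positivity

theorem matBound_truncSymbol (ω : Fin d → ℝ) (hκ : 0 ≤ κ) (ha : 0 ≤ a)
    (hφ : ∀ k, |φ k| ≤ κ * bracket k ^ (-(a + b))) (n : ℕ) :
    MatBound (expWeight b n) (Real.exp 1 * κ) (orbitMat ω (truncSymbol φ n)) := by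
  intro i j
  have hu := expWeight_nonneg b n (i - j)
  simp only [orbitMat, truncSymbol]
  split_ifs with h
  · have h1 := bracket_rpow_le_exp_mul_expWeight (b := b) h
    have h2 : bracket (i - j) ^ (-(a + b)) ≤ bracket (i - j) ^ (-b) :=
      Real.rpow_le_rpow_of_exponent_le (one_le_bracket _) (by linarith)
    rw [Complex.norm_real, Real.norm_eq_abs]
    calc |φ (i - j)| ≤ κ * bracket (i - j) ^ (-(a + b)) := hφ _
      _ ≤ κ * (Real.exp 1 * expWeight b n (i - j)) := by gcongr; exact h2.trans h1
      _ = _ := by ring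
  · rw [norm_zero]; positivity

end Trunc

/-! ### The iteration and its constants. -/

/-- An approximate diagonalization: `1 + Y` conjugates `D + T` to `D + g` up to the defect `F`. -/
structure KamState (d : ℕ) where
  Y : ZLat d → ℂ → ℂ
  F : ZLat d → ℂ → ℂ
  g : ℂ → ℂ

namespace KamState

variable {d : ℕ}

/-- The increment of `Y` in one step. -/
def incr (ω : Fin d → ℝ) (h : ZLat d → ℂ → ℂ) (S : KamState d) : ZLat d → ℂ → ℂ :=
  homologicalSol ω h S.F S.g + symMul ω S.Y (homologicalSol ω h S.F S.g)

/-- One diagonalization step, in which `T'` is added to the hopping. -/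
def step (ω : Fin d → ℝ) (h T' : ZLat d → ℂ → ℂ) (S : KamState d) : KamState d where
  Y := S.Y + S.incr ω h
  F := -symMul ω S.Y S.F + symMul ω S.F (homologicalSol ω h S.F S.g) +
    -(fun k z => S.incr ω h k z * S.F 0 (z - latDot k ω)) + T' +
    symMul ω T' (S.Y + S.incr ω h)
  g := fun z => S.g z + S.F 0 z

/-- The quantitative properties of an approximate diagonalization. -/
structure Valid (ω : Fin d → ℝ) (D : ZLat d → ℂ) (T : ZLat d → ℂ → ℂ) (u : ZLat d → ℝ)
    (r y ε η : ℝ) (S : KamState d) : Prop where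
  holFam_Y : HolFam r u y S.Y
  holFam_F : HolFam r u ε S.F
  hol_g : PeriodicHol r S.g
  lip_g : RealLip r η S.g
  defect_eq : defect D (fun j => S.g (latDot j ω)) (orbitMat ω T) (orbitMat ω S.Y) =
    orbitMat ω S.F

variable {ω : Fin d → ℝ} {D : ZLat d → ℂ} {h T T' : ZLat d → ℂ → ℂ} {u v : ZLat d → ℝ}
  {r r' C c y ε η w t t' : ℝ} {S : KamState d}

theorem Valid.holFam_incr (hS : S.Valid ω D T u r y ε η) (hv : ConvWeight C v)
    (huv : ∀ k, u k ≤ v k) (hy : 0 ≤ y) (hw : 0 ≤ w)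
    (hW : HolFam r v w (homologicalSol ω h S.F S.g)) :
    HolFam r v (w + y * w * C) (S.incr ω h) :=
  hW.add ((hS.holFam_Y.mono le_rfl fun k => mul_le_mul_of_nonneg_left (huv k) hy).symMul hW hv hy hw)

/-- Y and F are re-read in the larger weight v, in which W lives. Since u 0 = 1, the diagonal symbol
F_0 is bounded by ε, and Cauchy's estimate on the narrower strip makes it ε/(r-r')-Lipschitz. -/
theorem Valid.step (hS : S.Valid ω D T u r y ε η) (hv : ConvWeight C v) (hC : 0 ≤ C)
    (huv : ∀ k, u k ≤ v k) (hu0 : u 0 = 1) (hr' : 0 < r') (hr : r' < r)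
    (hy : 0 ≤ y) (hε : 0 ≤ ε) (hη : η ≤ c / 2) (hw : 0 ≤ w) (ht : 0 ≤ t) (ht' : 0 ≤ t')
    (hh : DivisorInverse r c ω D h) (hT : MatBound v t (orbitMat ω T)) (hT' : HolFam r v t' T')
    (hW : HolFam r v w (homologicalSol ω h S.F S.g)) :
    (S.step ω h T').Valid ω D (T + T') v r' (y + (w + y * w * C))
      (y * ε * C + ε * w * C + (w + y * w * C) * ε + t' + t' * (y + (w + y * w * C)) * C)
      (η + ε / (r - r')) := by
  have hr0 : 0 < r := hr'.trans hr
  have hY := hS.holFam_Y.mono (v := v) le_rfl fun k => mul_le_mul_of_nonneg_left (huv k) hy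
  have hF := hS.holFam_F.mono (v := v) le_rfl fun k => mul_le_mul_of_nonneg_left (huv k) hε
  have hZ := hS.holFam_incr hv huv hy hw hW
  have hY' := hY.add hZ
  have hF0 : ∀ z ∈ strip r, ‖S.F 0 z‖ ≤ ε := fun z hz => by
    simpa [hu0] using hS.holFam_F.bound 0 z hz
  have hy' : 0 ≤ y + (w + y * w * C) := by positivity
  refine ⟨hY'.mono hr.le fun _ => le_rfl, ?_, ?_, ?_, ?_⟩
  · exact (((((hY.symMul hF hv hy hε).neg.add (hF.symMul hW hv hε hw)).add
      (hZ.mul_diag (hS.holFam_F.hol 0) hF0).neg).add hT').add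
      (hT'.symMul hY' hv ht' hy')).mono hr.le fun _ => le_rfl
  · exact (hS.hol_g.add (hS.holFam_F.hol 0)).mono hr.le
  · intro z hz x
    have h1 := hS.lip_g z (strip_mono hr.le hz) x
    have h2 := (hS.holFam_F.hol 0).norm_sub_shift_le hr hF0 hz x
    calc ‖S.g z + S.F 0 z - (S.g (z - x) + S.F 0 (z - x))‖
        = ‖(S.g z - S.g (z - x)) + (S.F 0 z - S.F 0 (z - x))‖ := by congr 1; ring
      _ ≤ _ := (norm_add_le _ _).trans (by rw [add_mul]; exact add_le_add h1 h2)
  · have key := defect_step hv ht hy hw hT (hT'.matBound (ω := ω) hr0) (hY.matBound hr0)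
      (hW.matBound hr0) (hF.matBound hr0) hS.defect_eq
      (fun i => by simp [orbitMat, homologicalSol])
      (fun i j hij => homologicalSol_eq hr0 hh hS.lip_g hη hij)
    have hmul := fun A B => orbitMat_symMul (d := d) ω A B
    have hadd : ∀ A B : ZLat d → ℂ → ℂ, orbitMat ω (A + B) = orbitMat ω A + orbitMat ω B :=
      fun _ _ => rfl
    have hneg : ∀ A : ZLat d → ℂ → ℂ, orbitMat ω (-A) = -orbitMat ω A := fun _ => rfl
    have hdiag : orbitMat ω (fun k z => S.incr ω h k z * S.F 0 (z - latDot k ω)) =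
        fun i j => orbitMat ω (S.incr ω h) i j * orbitMat ω S.F j j := by
      funext i j
      simp only [orbitMat, sub_self]
      congr 2
      rw [latDot_sub]; push_cast; ring
    have hg : (fun j => (S.step ω h T').g (latDot j ω)) =
        fun j => S.g (latDot j ω) + orbitMat ω S.F j j := by
      funext j; simp [KamState.step, orbitMat]
    rw [hg]
    simp only [KamState.step, hadd, hneg, hmul, hdiag]
    have hi : orbitMat ω (S.incr ω h) = orbitMat ω (homologicalSol ω h S.F S.g) +
        matMul (orbitMat ω S.Y) (orbitMat ω (homologicalSol ω h S.F S.g)) := by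
      rw [incr, hadd, hmul]
    rw [hi, key]
    funext i j
    simp only [Pi.add_apply, Pi.neg_apply]
    ring

end KamState

theorem KamState.Valid.mono {d : ℕ} {ω : Fin d → ℝ} {D : ZLat d → ℂ} {T : ZLat d → ℂ → ℂ}
    {u : ZLat d → ℝ} {r r' y y' ε ε' η η' : ℝ} {S : KamState d} (hS : S.Valid ω D T u r y ε η)
    (hu : ∀ k, 0 ≤ u k) (hr : r' = r) (hy : y ≤ y') (hε : ε ≤ ε') (hη : η ≤ η') :
    S.Valid ω D T u r' y' ε' η' := by
  subst hr
  exact ⟨hS.holFam_Y.mono le_rfl fun k => mul_le_mul_of_nonneg_right hy (hu k),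
    hS.holFam_F.mono le_rfl fun k => mul_le_mul_of_nonneg_right hε (hu k), hS.hol_g,
    fun z hz x => (hS.lip_g z hz x).trans (mul_le_mul_of_nonneg_right hη (norm_nonneg _)),
    hS.defect_eq⟩

/-- The iterated approximate diagonalizations. -/
def kamSeq {d : ℕ} (ω : Fin d → ℝ) (h : ZLat d → ℂ → ℂ) (φ : ZLat d → ℝ) : ℕ → KamState d
  | 0 => ⟨0, truncSymbol φ 0, fun _ => 0⟩
  | n + 1 => (kamSeq ω h φ n).step ω h (truncSymbol φ (n + 1) - truncSymbol φ n)

/-- Constants for which the iteration converges: the defects decay like `(θ²)^n`, and each step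
loses a factor `B^n`, where `B θ² < 1`. -/
structure KamConstants (θ B L C K M Q R κ c : ℝ) : Prop where
  θ_pos : 0 < θ
  θ_lt : θ < 1
  B_pos : 0 < B
  rate_lt : B * θ ^ 2 < 1
  L_nonneg : 0 ≤ L
  C_ge : 1 ≤ C
  R_pos : 0 < R
  κ_nonneg : 0 ≤ κ
  K_eq : K * θ ^ 2 = 2 * (Real.exp 1 * (1 + C))
  M_eq : M * (1 - B * θ ^ 2) = L * K * (1 + C)
  Q_eq : Q * (R * (1 - θ) ^ 2) = K
  M_le : M * κ ≤ 1
  Q_le : Q * κ ≤ c / 2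
  κ_le : κ * (M * K * C + L * K ^ 2 * C + L * K ^ 2 * (1 + C)) ≤ K * θ ^ 2 / 2

namespace KamConstants

variable {θ B L C K M Q R κ c : ℝ}

theorem K_pos (hp : KamConstants θ B L C K M Q R κ c) : 0 < K := by
  have h1 := hp.θ_pos
  have h2 := hp.C_ge
  have h3 : 0 < K * θ ^ 2 := by rw [hp.K_eq]; positivity
  exact pos_of_mul_pos_left h3 (by positivity)

theorem M_nonneg (hp : KamConstants θ B L C K M Q R κ c) : 0 ≤ M := by
  have h1 := hp.K_pos
  have h2 := hp.C_ge
  have h4 := hp.L_nonneg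
  have h5 := hp.rate_lt
  have h3 : 0 ≤ M * (1 - B * θ ^ 2) := by rw [hp.M_eq]; positivity
  exact nonneg_of_mul_nonneg_left h3 (by linarith)

theorem Q_pos (hp : KamConstants θ B L C K M Q R κ c) : 0 < Q := by
  have h1 := hp.R_pos
  have h2 := sub_pos.mpr hp.θ_lt
  have h3 : 0 < Q * (R * (1 - θ) ^ 2) := by rw [hp.Q_eq]; exact hp.K_pos
  exact pos_of_mul_pos_left h3 (by positivity)

/-- Used with q = (Bθ²)^n. As Mκ(1-q) ≤ 1, the increment is at most LKκ(1+C)q, and the choice of M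
makes these telescope to Mκ(1 - q). -/
theorem step_Y (hp : KamConstants θ B L C K M Q R κ c) {q : ℝ} (hq : 0 ≤ q) :
    M * κ * (1 - q) + (L * K * κ * q + M * κ * (1 - q) * (L * K * κ * q) * C) ≤
      M * κ * (1 - B * θ ^ 2 * q) := by
  have hK := hp.K_pos
  have hM := hp.M_nonneg
  have hL := hp.L_nonneg
  have hκ := hp.κ_nonneg
  have hC := hp.C_ge
  have h1 : M * κ * (1 - q) ≤ 1 := by
    have : 0 ≤ M * κ * q := by positivity
    linarith [hp.M_le]
  have h2 : 0 ≤ L * K * κ * q * C := by positivity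
  have h3 := mul_le_mul_of_nonneg_right h1 h2
  have h4 := congrArg (· * (κ * q)) hp.M_eq
  linarith

/-- Used with p = (θ²)^n and q = (Bθ²)^n. Half of Kθ² pays for the new shell T' and for T'Y',
through `K_eq`; the other half pays for the terms quadratic in κ, through `κ_le`. -/
theorem step_F (hp : KamConstants θ B L C K M Q R κ c) {p q : ℝ} (hq : 0 ≤ q) (hq1 : q ≤ 1)
    (hp0 : 0 ≤ p) :
    M * κ * (1 - q) * (K * κ * p) * C + K * κ * p * (L * K * κ * q) * C +
      (L * K * κ * q + M * κ * (1 - q) * (L * K * κ * q) * C) * (K * κ * p) +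
      Real.exp 1 * κ * p +
      Real.exp 1 * κ * p *
        (M * κ * (1 - q) + (L * K * κ * q + M * κ * (1 - q) * (L * K * κ * q) * C)) * C ≤
      K * κ * (θ ^ 2 * p) := by
  have hK := hp.K_pos
  have hM := hp.M_nonneg
  have hL := hp.L_nonneg
  have hκ := hp.κ_nonneg
  have hC := hp.C_ge
  have hB := hp.B_pos
  have he := Real.exp_pos 1
  have h0 : 0 ≤ M * κ * q := by positivity
  have h1 : M * κ * (1 - q) ≤ 1 := by linarith [hp.M_le]
  have h1' : M * κ * (1 - q) ≤ M * κ := by linarith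
  have hw : L * K * κ * q ≤ L * K * κ := mul_le_of_le_one_right (by positivity) hq1
  have hw0 : 0 ≤ L * K * κ * q := by positivity
  have hz : L * K * κ * q + M * κ * (1 - q) * (L * K * κ * q) * C ≤ L * K * κ * (1 + C) := by
    have := mul_le_mul_of_nonneg_right h1 (mul_nonneg hw0 (by linarith : (0:ℝ) ≤ C))
    have := mul_le_mul_of_nonneg_right hw (by linarith : 0 ≤ 1 + C)
    linarith
  have hy : M * κ * (1 - q) + (L * K * κ * q + M * κ * (1 - q) * (L * K * κ * q) * C) ≤ 1 := by
    refine (hp.step_Y hq).trans ?_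
    have : 0 ≤ M * κ * (B * θ ^ 2 * q) := by positivity
    linarith [hp.M_le]
  have t1 : M * κ * (1 - q) * (K * κ * p) * C ≤ M * κ * (K * κ * p) * C := by gcongr
  have t2 : K * κ * p * (L * K * κ * q) * C ≤ K * κ * p * (L * K * κ) * C := by gcongr
  have t3 := mul_le_mul_of_nonneg_right hz (by positivity : 0 ≤ K * κ * p)
  have t4 := mul_le_mul_of_nonneg_left hy (by positivity : 0 ≤ Real.exp 1 * κ * p * C)
  have t5 := mul_le_mul_of_nonneg_right hp.κ_le (by positivity : 0 ≤ κ * p)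
  have t6 := congrArg (· * (κ * p)) hp.K_eq
  linarith

/-- Used with x = θ^n. The strip narrows by Rx(1-θ) while the defect is Kκx², so one factor x
survives Cauchy's estimate; Q makes the sum telescope exactly. -/
theorem step_g (hp : KamConstants θ B L C K M Q R κ c) {x : ℝ} (hx : 0 < x) :
    Q * κ * (1 - x) + K * κ * x ^ 2 / (R * (1 + x) - R * (1 + θ * x)) ≤ Q * κ * (1 - θ * x) := by
  have h1 := sub_pos.mpr hp.θ_lt
  have h2 := hp.R_pos
  have e : R * (1 + x) - R * (1 + θ * x) = R * x * (1 - θ) := by ring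
  have e2 : K * κ * x ^ 2 / (R * (1 + x) - R * (1 + θ * x)) = Q * κ * x * (1 - θ) := by
    rw [e, div_eq_iff (by positivity), ← hp.Q_eq]; ring
  rw [e2]
  exact le_of_eq (by ring)

end KamConstants

section Iteration

variable {d : ℕ} {a b τ γ Cτ θ C K M Q R κ c : ℝ} {ω : Fin d → ℝ} {D : ZLat d → ℂ}
  {h : ZLat d → ℂ → ℂ} {φ : ZLat d → ℝ}

theorem pow_mul_sq_pow (B θ : ℝ) (n : ℕ) : B ^ n * (θ ^ 2) ^ n = (B * θ ^ 2) ^ n :=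
  (mul_pow _ _ _).symm

/-- Strip widths fall from 2R towards R. The bounds on Y and on the Lipschitz constant of g increase
but stay below Mκ ≤ 1 and Qκ ≤ c/2, so the step always applies. The increment bound serves the
passage to the limit. -/
theorem kamSeq_valid (hp : KamConstants θ (2 ^ τ) (2 * Cτ / (c * γ)) C K M Q R κ c)
    (hθ : θ ^ 2 = 2 ^ (-a)) (ha : 0 ≤ a) (hc : 0 < c) (hγ : 0 < γ)
    (hu : ∀ n, ConvWeight C (expWeight (d := d) b n))
    (hC : ∀ t : ℝ, 0 ≤ t → t ^ τ ≤ Cτ * Real.exp (t / 2)) (hC1 : 1 ≤ Cτ)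
    (hω : Diophantine τ γ ω) (hh : DivisorInverse (2 * R) c ω D h)
    (hφ : ∀ k, |φ k| ≤ κ * bracket k ^ (-(a + b))) (n : ℕ) :
    (kamSeq ω h φ n).Valid ω D (truncSymbol φ n) (expWeight b n) (R * (1 + θ ^ n))
        (M * κ * (1 - (2 ^ τ * θ ^ 2) ^ n)) (K * κ * (θ ^ 2) ^ n) (Q * κ * (1 - θ ^ n)) ∧
      HolFam (R * (1 + θ ^ n)) (expWeight b (n + 1))
        (2 * Cτ / (c * γ) * K * κ * (1 + C) * (2 ^ τ * θ ^ 2) ^ n)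
        ((kamSeq ω h φ n).incr ω h) := by
  have hK := hp.K_pos
  have hM := hp.M_nonneg
  have hL := hp.L_nonneg
  have hκ := hp.κ_nonneg
  have hC' := hp.C_ge
  have hB := hp.B_pos
  have hθ0 := hp.θ_pos
  have hR := hp.R_pos
  have hQ := hp.Q_pos
  have hq0 : ∀ n : ℕ, 0 ≤ ((2 : ℝ) ^ τ * θ ^ 2) ^ n := fun n => by positivity
  have hq1 : ∀ n : ℕ, ((2 : ℝ) ^ τ * θ ^ 2) ^ n ≤ 1 := fun n =>
    pow_le_one₀ (by positivity) hp.rate_lt.le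
  have hθn : ∀ n : ℕ, θ ^ n ≤ 1 := fun n => pow_le_one₀ hθ0.le hp.θ_lt.le
  have hr2 : ∀ n : ℕ, R * (1 + θ ^ n) ≤ 2 * R := fun n => by
    have := mul_le_mul_of_nonneg_left (hθn n) hR.le
    linarith
  have hη : ∀ n : ℕ, Q * κ * (1 - θ ^ n) ≤ c / 2 := fun n => by
    have : 0 ≤ Q * κ * θ ^ n := by positivity
    linarith [hp.Q_le]
  have hy0 : ∀ n : ℕ, 0 ≤ M * κ * (1 - (2 ^ τ * θ ^ 2) ^ n) := fun n =>
    mul_nonneg (by positivity) (sub_nonneg.mpr (hq1 n))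
  have hε0 : ∀ n : ℕ, 0 ≤ K * κ * (θ ^ 2) ^ n := fun n => by positivity
  -- the solution of the homological equation at a valid state
  have hsol : ∀ n, (kamSeq ω h φ n).Valid ω D (truncSymbol φ n) (expWeight b n) (R * (1 + θ ^ n))
        (M * κ * (1 - (2 ^ τ * θ ^ 2) ^ n)) (K * κ * (θ ^ 2) ^ n) (Q * κ * (1 - θ ^ n)) →
      HolFam (R * (1 + θ ^ n)) (expWeight b (n + 1))
        (2 * Cτ / (c * γ) * K * κ * (2 ^ τ * θ ^ 2) ^ n)
        (homologicalSol ω h (kamSeq ω h φ n).F (kamSeq ω h φ n).g) := fun n hn => by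
    refine (holFam_homologicalSol hc hγ (hε0 n) hω (hh.mono (hr2 n)) hn.lip_g hn.hol_g (hη n) hC
      hC1 hn.holFam_F).mono le_rfl fun k => le_of_eq ?_
    rw [← pow_mul_sq_pow]; ring
  have hw0 : ∀ n : ℕ, 0 ≤ 2 * Cτ / (c * γ) * K * κ * (2 ^ τ * θ ^ 2) ^ n := fun n => by
    positivity
  have hvalid : ∀ n, (kamSeq ω h φ n).Valid ω D (truncSymbol φ n) (expWeight b n)
        (R * (1 + θ ^ n)) (M * κ * (1 - (2 ^ τ * θ ^ 2) ^ n)) (K * κ * (θ ^ 2) ^ n)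
        (Q * κ * (1 - θ ^ n)) := by
    intro n
    induction n with
    | zero =>
      refine ⟨?_, ?_, PeriodicHol.const 0, fun z _ x => ?_, ?_⟩
      · exact (HolFam.zero (u := expWeight b 0)).mono le_rfl fun k => by simp
      · refine (holFam_truncSymbol_zero _ hκ ha hφ).mono le_rfl fun k => ?_
        have h1 : Real.exp 1 ≤ K := by
          have h2 := hp.K_eq
          have h3 : K * θ ^ 2 ≤ K := mul_le_of_le_one_right hK.le (by
            exact pow_le_one₀ hθ0.le hp.θ_lt.le)
          have h4 : 0 ≤ Real.exp 1 * C := by positivity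
          linarith [Real.exp_pos 1]
        have hk := expWeight_nonneg b 0 k
        rw [pow_zero, mul_one]
        gcongr
      · simp [kamSeq]
      · funext i j
        simp [defect, kamSeq, orbitMat, matMul]
    | succ n ih =>
      have hT := fun i j => (matBound_truncSymbol (b := b) ω hκ ha hφ n i j).trans
        (mul_le_mul_of_nonneg_left (expWeight_le_succ b n (i - j))
          (by positivity : 0 ≤ Real.exp 1 * κ))
      have hr : R * (1 + θ ^ (n + 1)) < R * (1 + θ ^ n) := by
        have : θ ^ (n + 1) < θ ^ n := pow_lt_pow_right_of_lt_one₀ hθ0 hp.θ_lt (Nat.lt_succ_self n)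
        gcongr
      have hstep := ih.step (hu (n + 1)) (by linarith) (expWeight_le_succ b n) (expWeight_zero b n)
        (by positivity) hr (hy0 n) (hε0 n) (hη n) (hw0 n) (by positivity : 0 ≤ Real.exp 1 * κ)
        (by positivity : 0 ≤ Real.exp 1 * κ * (2 ^ (-a)) ^ n) (hh.mono (hr2 n)) hT
        (holFam_truncSymbol_sub _ hκ ha hφ n) (hsol n ih)
      rw [add_sub_cancel] at hstep
      refine hstep.mono (expWeight_nonneg b _) rfl ?_ ?_ ?_
      · refine (hp.step_Y (hq0 n)).trans (le_of_eq ?_)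
        rw [pow_succ' ((2 : ℝ) ^ τ * θ ^ 2)]
      · rw [← hθ, pow_succ' (θ ^ 2)]
        exact hp.step_F (hq0 n) (hq1 n) (by positivity)
      · have := hp.step_g (x := θ ^ n) (by positivity)
        rw [pow_succ' θ n, ← pow_mul, mul_comm 2 n, pow_mul]
        exact this
  refine ⟨hvalid n, ?_⟩
  refine ((hvalid n).holFam_incr (hu (n + 1)) (expWeight_le_succ b n) (hy0 n) (hw0 n)
    (hsol n (hvalid n))).mono le_rfl fun k => ?_
  refine mul_le_mul_of_nonneg_right ?_ (expWeight_nonneg b _ k)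
  have h1 : M * κ * (1 - (2 ^ τ * θ ^ 2) ^ n) ≤ 1 := by
    have : 0 ≤ M * κ * (2 ^ τ * θ ^ 2) ^ n := by positivity
    linarith [hp.M_le]
  have h2 := mul_le_mul_of_nonneg_right h1 (mul_nonneg (hw0 n) (by linarith : (0:ℝ) ≤ C))
  linarith

end Iteration

open Filter Topology in
theorem eventually_mul_le_of_pos (x : ℝ) {y : ℝ} (hy : 0 < y) :
    ∀ᶠ κ : ℝ in 𝓝[>] 0, κ * x ≤ y := by
  have h : Tendsto (fun κ : ℝ => κ * x) (𝓝[>] 0) (𝓝 0) := by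
    have : Tendsto (fun κ : ℝ => κ * x) (𝓝 0) (𝓝 (0 * x)) := tendsto_id.mul_const x
    rw [zero_mul] at this
    exact this.mono_left nhdsWithin_le_nhds
  exact (h.eventually_lt_const hy).mono fun _ h => h.le

/-! ### Passage to the limit. -/

/-- A geometric gain compensates the loss of `m` powers of `|k|`. -/
theorem pow_mul_expWeight_le {d : ℕ} {m Cm q ν b : ℝ} (hν : 0 ≤ ν) (hq : q * 2 ^ m = ν)
    (hm : 0 ≤ m) (hC1 : 1 ≤ Cm)
    (hC : ∀ t : ℝ, 0 ≤ t → t ^ m ≤ Cm * Real.exp (t / 2)) (n : ℕ) (k : ZLat d) :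
    q ^ n * expWeight b (n + 1) k ≤ Cm * 2 ^ m * ν ^ n * bracket k ^ (-(m + b)) := by
  have h2m : (1 : ℝ) ≤ 2 ^ m := Real.one_le_rpow (by norm_num) hm
  have hbk := bracket_pos k
  have key : bracket k ^ m * expWeight b (n + 1) k ≤ Cm * (2 ^ m) ^ (n + 1) * bracket k ^ (-b) := by
    by_cases hk : k = 0
    · subst hk
      rw [expWeight_zero, bracket_zero, Real.one_rpow, Real.one_rpow, mul_one, mul_one]
      exact one_le_mul_of_one_le_of_one_le hC1 (one_le_pow₀ h2m)
    · rw [bracket_eq_norm hk]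
      refine (norm_rpow_mul_expWeight_le b hC (n + 1) k).trans ?_
      rw [← bracket_eq_norm hk]
      gcongr
      exact expWeight_le_bracket _ _ _
  have hq0 : 0 ≤ q := by
    have : 0 ≤ q * 2 ^ m := by rw [hq]; exact hν
    exact nonneg_of_mul_nonneg_left this (by linarith)
  have h3 : bracket k ^ (-(m + b)) = bracket k ^ (-b) / bracket k ^ m := by
    rw [← Real.rpow_sub hbk]; congr 1; ring
  rw [h3, mul_div_assoc', le_div_iff₀ (Real.rpow_pos_of_pos hbk m)]
  calc q ^ n * expWeight b (n + 1) k * bracket k ^ m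
      = q ^ n * (bracket k ^ m * expWeight b (n + 1) k) := by ring
    _ ≤ q ^ n * (Cm * (2 ^ m) ^ (n + 1) * bracket k ^ (-b)) := by gcongr
    _ = Cm * 2 ^ m * (q * 2 ^ m) ^ n * bracket k ^ (-b) := by rw [mul_pow, pow_succ]; ring
    _ = _ := by rw [hq]

open Filter Topology in
/-- Diagonalization of `D + T_φ` with a small hopping `φ` of power law decay. -/
theorem exists_diagonalization (d : ℕ) {a b τ γ c R m ζ : ℝ} (hb : (d : ℝ) < b) (hτ : 0 < τ)
    (hγ : 0 < γ) (hc : 0 < c) (hR : 0 < R) (hm : 0 ≤ m) (hma : m < a - τ) (hζ : 0 < ζ) :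
    ∃ κ : ℝ, 0 < κ ∧ ∀ (ω : Fin d → ℝ) (φ : ZLat d → ℝ) (D : ZLat d → ℂ) (h : ZLat d → ℂ → ℂ),
      Diophantine τ γ ω → DivisorInverse (2 * R) c ω D h →
      (∀ k, |φ k| ≤ κ * bracket k ^ (-(a + b))) →
      ∃ (Y : ZLat d → ZLat d → ℂ) (g : ZLat d → ℂ),
        (∀ i j, ‖Y i j‖ ≤ ζ * bracket (i - j) ^ (-(m + b))) ∧
        ∀ i j, defect D g (fun i j => (φ (i - j) : ℂ)) Y i j = 0 := by
  have ha : 0 < a := by linarith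
  obtain ⟨C, hC1, hu⟩ := exists_convWeight d hb
  obtain ⟨Cτ, hCτ1, hCτ⟩ := exists_rpow_le_exp_half hτ.le
  obtain ⟨Cm, hCm1, hCm⟩ := exists_rpow_le_exp_half hm
  -- θ² = 2^{-a} is the decay rate of the hopping shells. The strips shrink at the slower rate θ, so
  -- the Lipschitz increments θ^{2n}/θ^n are still summable.
  set θ : ℝ := 2 ^ (-(a / 2)) with hθdef
  have hθ2 : θ ^ 2 = 2 ^ (-a) := by
    rw [hθdef, ← Real.rpow_natCast, ← Real.rpow_mul (by norm_num)]; congr 1; push_cast; ring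
  have hθ0 : 0 < θ := Real.rpow_pos_of_pos (by norm_num) _
  have hθ1 : θ < 1 := Real.rpow_lt_one_of_one_lt_of_neg (by norm_num) (by linarith)
  set q : ℝ := 2 ^ τ * θ ^ 2 with hqdef
  have hq : q = 2 ^ (τ - a) := by
    rw [hqdef, hθ2, ← Real.rpow_add (by norm_num)]; congr 1
  have hq1 : q < 1 := by
    rw [hq]; exact Real.rpow_lt_one_of_one_lt_of_neg (by norm_num) (by linarith)
  have hq0 : 0 < q := by rw [hq]; exact Real.rpow_pos_of_pos (by norm_num) _
  set ν : ℝ := q * 2 ^ m with hνdef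
  have hν : ν = 2 ^ (τ - a + m) := by rw [hνdef, hq, ← Real.rpow_add (by norm_num)]
  have hν1 : ν < 1 := by
    rw [hν]; exact Real.rpow_lt_one_of_one_lt_of_neg (by norm_num) (by linarith)
  have hν0 : 0 < ν := by rw [hν]; exact Real.rpow_pos_of_pos (by norm_num) _
  set L : ℝ := 2 * Cτ / (c * γ) with hL
  have hL0 : 0 < L := by positivity
  set K : ℝ := 2 * (Real.exp 1 * (1 + C)) / θ ^ 2 with hK
  have hK0 : 0 < K := by positivity
  set M : ℝ := L * K * (1 + C) / (1 - q) with hM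
  set Q : ℝ := K / (R * (1 - θ) ^ 2) with hQ
  have h1θ : 0 < 1 - θ := by linarith
  have h1q : 0 < 1 - q := by linarith
  -- Every requirement has the form κ·x ≤ y with y > 0, hence holds for small κ > 0. The fourth
  -- bounds the geometric sum of all increments of Y by ζ.
  obtain ⟨κ, ⟨⟨⟨⟨hκ1, hκ2⟩, hκ3⟩, hκ4⟩, hκ0⟩⟩ :=
    (((((eventually_mul_le_of_pos M one_pos).and
      (eventually_mul_le_of_pos Q (half_pos hc))).and
      (eventually_mul_le_of_pos (M * K * C + L * K ^ 2 * C + L * K ^ 2 * (1 + C))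
        (by positivity : 0 < K * θ ^ 2 / 2))).and
      (eventually_mul_le_of_pos (L * K * (1 + C) * (Cm * 2 ^ m) / (1 - ν)) hζ)).and
      (eventually_mem_nhdsWithin)).exists
  have hκ0 : 0 < κ := hκ0
  have hp : KamConstants θ (2 ^ τ) L C K M Q R κ c :=
    { θ_pos := hθ0, θ_lt := hθ1, B_pos := Real.rpow_pos_of_pos (by norm_num) _, rate_lt := hq1,
      L_nonneg := hL0.le, C_ge := hC1, R_pos := hR, κ_nonneg := hκ0.le
      K_eq := by rw [hK]; field_simp
      M_eq := by rw [hM, ← hqdef]; field_simp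
      Q_eq := by rw [hQ]; field_simp
      M_le := by rwa [mul_comm]
      Q_le := by rwa [mul_comm]
      κ_le := hκ3 }
  refine ⟨κ, hκ0, fun ω φ D h hω hh hφ => ?_⟩
  have hV := kamSeq_valid hp hθ2 ha.le hc hγ hu hCτ hCτ1 hω hh hφ
  have hrn : ∀ n : ℕ, 0 < R * (1 + θ ^ n) := fun n => by positivity
  set P : ℕ → ZLat d → ZLat d → ℂ := fun n => orbitMat ω (kamSeq ω h φ n).Y with hP
  set G : ℕ → ZLat d → ℂ := fun n j => (kamSeq ω h φ n).g (latDot j ω) with hG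
  set c₁ : ℝ := κ * (L * K * (1 + C) * (Cm * 2 ^ m)) with hc₁
  have hPdist : ∀ i j n, dist (P n i j) (P (n + 1) i j) ≤
      c₁ * bracket (i - j) ^ (-(m + b)) * ν ^ n := by
    intro i j n
    have h1 : P (n + 1) i j = P n i j + orbitMat ω ((kamSeq ω h φ n).incr ω h) i j := rfl
    rw [h1, dist_self_add_right]
    refine ((hV n).2.matBound (hrn n) i j).trans ?_
    have h2 := pow_mul_expWeight_le (b := b) hν0.le hνdef.symm hm hCm1 hCm n (i - j)
    have h3 := mul_le_mul_of_nonneg_left h2 (by positivity : 0 ≤ L * K * κ * (1 + C))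
    calc _ = L * K * κ * (1 + C) * (q ^ n * expWeight b (n + 1) (i - j)) := by ring
      _ ≤ _ := h3
      _ = _ := by rw [hc₁]; ring
  have hGdist : ∀ j n, dist (G n j) (G (n + 1) j) ≤ K * κ * (θ ^ 2) ^ n := by
    intro j n
    have h1 : G (n + 1) j = G n j + (kamSeq ω h φ n).F 0 (latDot j ω) := rfl
    rw [h1, dist_self_add_right]
    have := (hV n).1.holFam_F.bound 0 _ (ofReal_mem_strip (hrn n) (latDot j ω))
    rwa [expWeight_zero, mul_one] at this
  have hθ21 : θ ^ 2 < 1 := pow_lt_one₀ hθ0.le hθ1 two_ne_zero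
  have hPlim : ∀ i j, ∃ y, Tendsto (fun n => P n i j) atTop (𝓝 y) := fun i j =>
    cauchySeq_tendsto_of_complete (cauchySeq_of_le_geometric _ _ hν1 (hPdist i j))
  have hGlim : ∀ j, ∃ y, Tendsto (fun n => G n j) atTop (𝓝 y) := fun j =>
    cauchySeq_tendsto_of_complete (cauchySeq_of_le_geometric _ _ hθ21 (hGdist j))
  choose Y hY using hPlim
  choose g hg using hGlim
  refine ⟨Y, g, fun i j => ?_, fun i j => ?_⟩
  · have h1 := dist_le_of_le_geometric_of_tendsto₀ _ _ hν1 (hPdist i j) (hY i j)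
    have h0 : P 0 i j = 0 := rfl
    rw [h0, dist_zero_left] at h1
    refine h1.trans ?_
    rw [mul_div_right_comm]
    refine mul_le_mul_of_nonneg_right ?_ (Real.rpow_nonneg (bracket_pos _).le _)
    rw [hc₁, mul_div_assoc]; exact hκ4
  · have hTlim : ∀ i l, ∀ᶠ n in atTop,
        orbitMat ω (truncSymbol φ n) i l = (φ (i - l) : ℂ) := by
      intro i l
      obtain ⟨N, hN⟩ := pow_unbounded_of_one_lt ‖i - l‖ (one_lt_two : (1 : ℝ) < 2)
      filter_upwards [eventually_ge_atTop N] with n hn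
      have : ‖i - l‖ ≤ 2 ^ n := hN.le.trans (pow_le_pow_right₀ (by norm_num) hn)
      simp [orbitMat, truncSymbol, this]
    have hmul : Tendsto (fun n => matMul (orbitMat ω (truncSymbol φ n)) (P n) i j) atTop
        (𝓝 (matMul (fun i j => (φ (i - j) : ℂ)) Y i j)) := by
      -- The entries of `P n` are at most 1, and the truncated hopping is dominated by a power that
      -- is summable because b > d.
      refine tendsto_tsum_of_dominated_convergence
        (bound := fun l => κ * bracket (i - l) ^ (-b)) ?_ ?_ ?_
      · exact ((Equiv.subLeft i).summable_iff.mpr (summable_bracket_rpow hb)).mul_left κ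
      · intro l
        exact (tendsto_const_nhds.congr' ((hTlim i l).mono fun n hn => hn.symm)).mul (hY l j)
      · refine Eventually.of_forall fun n l => ?_
        have h1 : ‖P n l j‖ ≤ 1 := by
          refine ((hV n).1.holFam_Y.matBound (hrn n) l j).trans ?_
          have h2 : M * κ * (1 - q ^ n) ≤ 1 := by
            have : 0 ≤ M * κ * q ^ n := by
              have := hp.M_nonneg
              positivity
            linarith [hp.M_le]
          have h3 := expWeight_le_one ((Nat.cast_nonneg d).trans hb.le) n (l - j)
          have h4 := expWeight_nonneg b n (l - j)
          calc _ ≤ 1 * expWeight b n (l - j) := by gcongr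
            _ ≤ 1 := by linarith
        have h5 : ‖orbitMat ω (truncSymbol φ n) i l‖ ≤ κ * bracket (i - l) ^ (-b) := by
          refine (truncSymbol_norm_le n (i - l) _).trans ((hφ (i - l)).trans ?_)
          gcongr ?_ * ?_
          exact Real.rpow_le_rpow_of_exponent_le (one_le_bracket _) (by linarith)
        rw [norm_mul]
        calc _ ≤ κ * bracket (i - l) ^ (-b) * 1 :=
              mul_le_mul h5 h1 (norm_nonneg _) ((norm_nonneg _).trans h5)
          _ = _ := mul_one _
    have hdef : Tendsto (fun n => defect D (G n) (orbitMat ω (truncSymbol φ n)) (P n) i j) atTop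
        (𝓝 (defect D g (fun i j => (φ (i - j) : ℂ)) Y i j)) :=
      ((((hY i j).const_mul _).add (tendsto_const_nhds.congr'
        ((hTlim i j).mono fun n hn => hn.symm))).add hmul).sub
        (((hY i j).const_add _).mul (hg j))
    refine tendsto_nhds_unique hdef ?_
    have hF : ∀ n, ‖defect D (G n) (orbitMat ω (truncSymbol φ n)) (P n) i j‖ ≤
        K * κ * (θ ^ 2) ^ n := by
      intro n
      rw [(hV n).1.defect_eq]
      refine ((hV n).1.holFam_F.matBound (hrn n) i j).trans ?_
      exact mul_le_of_le_one_right (by positivity)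
        (expWeight_le_one ((Nat.cast_nonneg d).trans hb.le) n (i - j))
    refine squeeze_zero_norm hF ?_
    have := (tendsto_pow_atTop_nhds_zero_of_lt_one (sq_nonneg θ) hθ21).const_mul (K * κ)
    rwa [mul_zero] at this

/-! ### From diagonalization to a complete set of eigenfunctions. -/

/-- A diagonalization by `1 + Y`, with `Y` small and decaying, gives a complete set of localized
eigenfunctions. -/
theorem powerLawLocalized_of_defect_eq_zero {d : ℕ} {φ : ZLat d → ℝ} {D g : ZLat d → ℂ}
    {Y : ZLat d → ZLat d → ℂ} {β ζ q : ℝ} (hβ : (d : ℝ) < β) (hζ : 0 ≤ ζ) (hζ1 : ζ ≤ 1 / 2)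
    (hζs : ζ * ∑' k : ZLat d, bracket k ^ (-β) ≤ 1 / 2)
    (hY : ∀ i j, ‖Y i j‖ ≤ ζ * bracket (i - j) ^ (-β)) (hq : q ≤ β)
    (hφ : Summable fun k => (φ k : ℂ))
    (hdef : ∀ i j, defect D g (fun i j => (φ (i - j) : ℂ)) Y i j = 0) :
    PowerLawLocalized (latticeOp φ D) q := by
  have hβ0 : 0 ≤ β := (Nat.cast_nonneg d).trans hβ.le
  have hs := summable_bracket_rpow hβ
  have hsj : ∀ j : ZLat d, Summable fun i => bracket (i - j) ^ (-β) := fun j =>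
    (Equiv.subRight j).summable_iff.mpr hs
  have htj : ∀ j : ZLat d, ∑' i, bracket (i - j) ^ (-β) = ∑' k : ZLat d, bracket k ^ (-β) :=
    fun j => (Equiv.subRight j).tsum_eq fun k : ZLat d => bracket k ^ (-β)
  have hb1 : ∀ k : ZLat d, bracket k ^ (-β) ≤ 1 := fun k =>
    Real.rpow_le_one_of_one_le_of_nonpos (one_le_bracket k) (by linarith)
  have hYs : ∀ j, Summable fun i => ‖Y i j‖ := fun j =>
    Summable.of_nonneg_of_le (fun _ => norm_nonneg _) (fun i => hY i j) ((hsj j).mul_left ζ)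
  have hY1 : ∀ i j, ‖Y i j‖ ≤ 1 / 2 := fun i j => by
    have := mul_le_mul_of_nonneg_left (hb1 (i - j)) hζ
    linarith [hY i j]
  have hmem : ∀ j, Memℓp (fun i => (if i = j then (1 : ℂ) else 0) + Y i j) 2 := by
    intro j
    refine Memℓp.of_exponent_ge (q := 1) (memℓp_gen ?_) one_le_two
    simp only [ENNReal.toReal_one, Real.rpow_one]
    refine Summable.of_nonneg_of_le (fun _ => norm_nonneg _) (fun i => norm_add_le _ _)
      (Summable.add ?_ (hYs j))
    exact summable_of_ne_finset_zero (s := {j}) fun i hi => by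
      simp [Finset.mem_singleton.not.mp hi]
  set e : ZLat d → EllTwo d := fun j => ⟨_, hmem j⟩ with he
  have hei : ∀ j i, e j i = (if i = j then (1 : ℂ) else 0) + Y i j := fun _ _ => rfl
  have hφi : ∀ i, Summable fun l => ‖(φ (i - l) : ℂ)‖ := fun i =>
    ((Equiv.subLeft i).summable_iff.mpr hφ).norm
  have hsumY : ∀ i j, Summable fun l => (φ (i - l) : ℂ) * Y l j := by
    intro i j
    refine Summable.of_norm (Summable.of_nonneg_of_le (fun _ => norm_nonneg _) (fun l => ?_)
      (hφi i))
    rw [norm_mul]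
    exact mul_le_of_le_one_right (norm_nonneg _) ((hY1 l j).trans (by norm_num))
  have hhop : ∀ i j, HasSum (fun l => (φ (i - l) : ℂ) * e j l)
      ((φ (i - j) : ℂ) + matMul (fun i j => (φ (i - j) : ℂ)) Y i j) := by
    intro i j
    have h1 : HasSum (fun l => if l = j then (φ (i - j) : ℂ) else 0) (φ (i - j) : ℂ) :=
      hasSum_ite_eq j _
    refine (h1.add (hsumY i j).hasSum).congr_fun fun l => ?_
    rw [hei]
    by_cases h : l = j
    · subst h; simp; ring
    · simp [h]
  have heig : ∀ i j, hop φ (fun l => e j l) i + D i * e j i = (D j + g j) * e j i := by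
    intro i j
    have h1 : hop φ (fun l => e j l) i = _ := (hhop i j).tsum_eq
    have h2 := hdef i j
    rw [h1, hei]
    simp only [defect] at h2
    by_cases h : i = j
    · subst h; simp only [if_true] at *; linear_combination h2
    · simp only [h, if_false] at *; linear_combination h2
  have heigen : ∀ j, IsEigenfunction (latticeOp φ D) (e j) := by
    intro j
    refine ⟨fun h0 => ?_, ⟨fun i => (hhop i j).summable, ?_⟩, D j + g j, ?_⟩
    · have h1 : e j j = 0 := by rw [h0]; rfl
      rw [hei, if_pos rfl, add_comm] at h1
      have h2 := hY1 j j
      rw [eq_neg_of_add_eq_zero_left h1, norm_neg, norm_one] at h2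
      norm_num at h2
    · simp only [heig]
      exact (hmem j).const_smul (D j + g j)
    · ext i
      exact heig i j
  have hcomplete : IsCompleteSet (Set.range e) := by
    unfold IsCompleteSet
    rw [Submodule.topologicalClosure_eq_top_iff, Submodule.eq_bot_iff]
    intro u hu
    have horth : ∀ j, ∑' i, inner ℂ (e j i) (u i) = 0 := by
      intro j
      rw [← lp.inner_eq_tsum]
      exact hu (e j) (Submodule.subset_span ⟨j, rfl⟩)
    have hbdd : BddAbove (Set.range fun i => ‖u i‖) :=
      ⟨‖u‖, by rintro _ ⟨i, rfl⟩; exact lp.norm_apply_le_norm two_ne_zero u i⟩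
    set B : ℝ := ⨆ i, ‖u i‖ with hB
    have hle : ∀ i, ‖u i‖ ≤ B := fun i => le_ciSup hbdd i
    have hB0 : 0 ≤ B := (norm_nonneg _).trans (hle 0)
    -- Orthogonality to e_j gives u_j = -∑ u_i conj(Y_ij), at most B ζ ∑⟨k⟩^{-β}. Taking the
    -- supremum over j forces B = 0.
    have hhalf : ∀ j, ‖u j‖ ≤ B * (1 / 2) := by
      intro j
      have hbd : ∀ i, ‖u i * (starRingEnd ℂ) (Y i j)‖ ≤ B * ζ * bracket (i - j) ^ (-β) := by
        intro i
        rw [norm_mul, RCLike.norm_conj, mul_assoc]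
        exact mul_le_mul (hle i) (hY i j) (norm_nonneg _) hB0
      have hsum : Summable fun i => u i * (starRingEnd ℂ) (Y i j) :=
        Summable.of_norm_bounded ((hsj j).mul_left (B * ζ)) hbd
      have h1 : HasSum (fun i => if i = j then u j else 0) (u j) := hasSum_ite_eq j _
      have h2 : HasSum (fun i => inner ℂ (e j i) (u i))
          (u j + ∑' i, u i * (starRingEnd ℂ) (Y i j)) := by
        refine (h1.add hsum.hasSum).congr_fun fun i => ?_
        rw [hei, RCLike.inner_apply]
        by_cases h : i = j
        · subst h; simp; ring
        · simp [h]
      have h3 := h2.tsum_eq.symm.trans (horth j)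
      rw [eq_neg_of_add_eq_zero_left h3, norm_neg]
      refine (tsum_of_norm_bounded ((hsj j).mul_left (B * ζ)).hasSum hbd).trans ?_
      rw [tsum_mul_left, htj, mul_assoc]
      exact mul_le_mul_of_nonneg_left hζs hB0
    have hB' : B ≤ B * (1 / 2) := ciSup_le hhalf
    ext i
    have : ‖u i‖ ≤ 0 := (hle i).trans (by linarith)
    simpa using this
  refine ⟨?_, e, heigen, hcomplete, fun i k => ?_⟩
  · unfold HasPurePointSpectrum IsCompleteSet at *
    refine top_le_iff.mp (hcomplete.symm.trans_le ?_)
    exact Submodule.topologicalClosure_mono (Submodule.span_mono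
      (Set.range_subset_iff.mpr heigen))
  · have hqβ : bracket (i - k) ^ (-β) ≤ bracket (i - k) ^ (-q) :=
      Real.rpow_le_rpow_of_exponent_le (one_le_bracket _) (by linarith)
    have hq0 : 0 ≤ bracket (i - k) ^ (-q) := Real.rpow_nonneg (bracket_pos _).le _
    have h2 : ‖Y i k‖ ≤ 1 * bracket (i - k) ^ (-q) :=
      (hY i k).trans (mul_le_mul (by linarith) hqβ (Real.rpow_nonneg (bracket_pos _).le _)
        zero_le_one)
    have h1 : ‖(if i = k then (1 : ℂ) else 0)‖ ≤ bracket (i - k) ^ (-q) := by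
      by_cases h : i = k
      · subst h; simp [bracket_zero]
      · simpa [h] using hq0
    rw [hei]
    linarith [norm_add_le (if i = k then (1 : ℂ) else 0) (Y i k)]

/-! ### Smallness of the hopping. -/

/-- Interpolation between the decay `|k|^{-s}` and the smallness of the Sobolev norm. -/
theorem abs_le_of_polyHopping {d : ℕ} {s δ κ : ℝ} (hδ : 0 < δ) (hκ : 0 ≤ κ) {φ : ZLat d → ℝ}
    (hφ : PolyHopping s φ)
    (hn : hoppingNorm (s - (d : ℝ) / 2 - δ) φ ≤ κ ^ (((d : ℝ) / 2 + δ) / δ)) (k : ZLat d) :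
    |φ k| ≤ κ * bracket k ^ (-(s - δ)) := by
  have hd : (0 : ℝ) ≤ d := Nat.cast_nonneg d
  set σ : ℝ := s - (d : ℝ) / 2 - δ with hσ
  have hbk := bracket_pos k
  have hdec : ∀ k, |φ k| ≤ bracket k ^ (-s) := by
    intro k
    by_cases hk : k = 0
    · subst hk; simp [hφ.zero, bracket_zero]
    · rw [bracket_eq_norm hk]; exact hφ.decay k hk
  have hsum : Summable fun k : ZLat d => |φ k| ^ 2 * bracket k ^ (2 * σ) := by
    refine Summable.of_nonneg_of_le (fun k => ?_) (fun k => ?_)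
      (summable_bracket_rpow (b := d + 2 * δ) (by linarith))
    · exact mul_nonneg (sq_nonneg _) (Real.rpow_nonneg (bracket_pos k).le _)
    · have h1 : |φ k| ^ 2 ≤ (bracket k ^ (-s)) ^ 2 := by gcongr; exact hdec k
      calc _ ≤ (bracket k ^ (-s)) ^ 2 * bracket k ^ (2 * σ) :=
            mul_le_mul_of_nonneg_right h1 (Real.rpow_nonneg (bracket_pos k).le _)
        _ = _ := by
            rw [← Real.rpow_natCast, ← Real.rpow_mul (bracket_pos k).le,
              ← Real.rpow_add (bracket_pos k)]
            congr 1; rw [hσ]; push_cast; ring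
  set ε : ℝ := κ ^ (((d : ℝ) / 2 + δ) / δ) with hε
  have hσk : |φ k| ≤ ε * bracket k ^ (-σ) := by
    have h1 := hsum.le_tsum k fun l _ =>
      mul_nonneg (sq_nonneg _) (Real.rpow_nonneg (bracket_pos l).le _)
    have h2 := (Real.sqrt_le_sqrt h1).trans hn
    have h3 : |φ k| ^ 2 * bracket k ^ (2 * σ) = (|φ k| * bracket k ^ σ) ^ 2 := by
      rw [mul_pow, ← Real.rpow_natCast (bracket k ^ σ), ← Real.rpow_mul hbk.le]
      congr 2; push_cast; ring
    rw [h3, Real.sqrt_sq (mul_nonneg (abs_nonneg _) (Real.rpow_nonneg hbk.le _))] at h2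
    rw [Real.rpow_neg hbk.le, ← div_eq_mul_inv, le_div_iff₀ (Real.rpow_pos_of_pos hbk σ)]
    exact h2
  have hD : 0 < (d : ℝ) / 2 + δ := by linarith
  -- The exponents s and σ differ by d/2 + δ, so this t loses exactly δ from s; it also inverts the
  -- power in the hypothesis, ε^t = κ.
  set t : ℝ := δ / ((d : ℝ) / 2 + δ) with ht
  have ht0 : 0 < t := div_pos hδ hD
  have ht1 : t ≤ 1 := (div_le_one hD).mpr (by linarith)
  have hε0 : 0 ≤ ε := Real.rpow_nonneg hκ _
  have hsplit : |φ k| = |φ k| ^ t * |φ k| ^ (1 - t) := by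
    rw [← Real.rpow_add_of_nonneg (abs_nonneg _) ht0.le (by linarith)]
    rw [add_sub_cancel, Real.rpow_one]
  have hεt : ε ^ t = κ := by
    rw [hε, ← Real.rpow_mul hκ, ht]
    have : ((d : ℝ) / 2 + δ) / δ * (δ / ((d : ℝ) / 2 + δ)) = 1 := by field_simp
    rw [this, Real.rpow_one]
  have htD : t * ((d : ℝ) / 2 + δ) = δ := by rw [ht]; field_simp
  rw [hsplit]
  calc |φ k| ^ t * |φ k| ^ (1 - t)
      ≤ (ε * bracket k ^ (-σ)) ^ t * (bracket k ^ (-s)) ^ (1 - t) := by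
        refine mul_le_mul (Real.rpow_le_rpow (abs_nonneg _) hσk ht0.le)
          (Real.rpow_le_rpow (abs_nonneg _) (hdec k) (by linarith))
          (Real.rpow_nonneg (abs_nonneg _) _) ?_
        exact Real.rpow_nonneg (mul_nonneg hε0 (Real.rpow_nonneg hbk.le _)) _
    _ = κ * (bracket k ^ (-σ * t) * bracket k ^ (-s * (1 - t))) := by
        rw [Real.mul_rpow hε0 (Real.rpow_nonneg hbk.le _), hεt, ← Real.rpow_mul hbk.le,
          ← Real.rpow_mul hbk.le, mul_assoc]
    _ = κ * bracket k ^ (-(s - δ)) := by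
        rw [← Real.rpow_add hbk]
        congr 2
        rw [hσ]; linear_combination htD

/-! ### Inverse divisors of a meromorphic potential. -/

theorem analyticAt_of_comp_sub {f : ℂ → ℂ} {z x : ℂ} (h : AnalyticAt ℂ (fun w => f (w - x)) z) :
    AnalyticAt ℂ f (z - x) := by
  have h1 : AnalyticAt ℂ (fun w => w + x) (z - x) := by fun_prop
  have h2 : AnalyticAt ℂ (fun w => f (w - x)) ((fun w => w + x) (z - x)) := by simpa using h
  have h3 := AnalyticAt.comp (f := fun w => w + x) (g := fun w => f (w - x)) h2 h1
  have e : (fun w => f (w - x)) ∘ (fun w => w + x) = f := by funext w; simp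
  rwa [e] at h3

theorem apply_add_intCast_of_periodic {r : ℝ} {f : ℂ → ℂ} (hf : ∀ z ∈ strip r, f (z + 1) = f z)
    (n : ℤ) : ∀ z ∈ strip r, f (z + n) = f z := by
  induction n using Int.induction_on with
  | zero => simp
  | succ n ih =>
    intro z hz
    have h := hf _ (add_intCast_mem_strip hz n)
    rw [ih z hz] at h
    rw [← h]; push_cast; rw [add_assoc]
  | pred n ih =>
    intro z hz
    have h := hf _ (add_intCast_mem_strip hz (-n - 1))
    rw [← h, ← ih z hz]; push_cast; congr 1; ring

open Filter Topology in
/-- The inverse of the difference `f(z) - f(z - x)` extends holomorphically across the poles. -/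
theorem exists_divisorInverse_of_separated {r c x : ℝ} {f : ℂ → ℂ} (hc : 0 < c)
    (hx : 0 < ‖(x : UnitAddCircle)‖) (hmer : MeromorphicOn f (strip r))
    (hper : ∀ z ∈ strip r, f (z + 1) = f z)
    (hsep : ∀ z ∈ strip r, AnalyticAt ℂ f z → AnalyticAt ℂ f (z - x) →
      c * ‖(x : UnitAddCircle)‖ ≤ ‖f z - f (z - x)‖) :
    ∃ h : ℂ → ℂ, PeriodicHol r h ∧ (∀ z ∈ strip r, c * ‖(x : UnitAddCircle)‖ * ‖h z‖ ≤ 1) ∧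
      ∀ z ∈ strip r, AnalyticAt ℂ f z → AnalyticAt ℂ f (z - x) →
        (f z - f (z - x)) * h z = 1 := by
  have hcx : 0 < c * ‖(x : UnitAddCircle)‖ := mul_pos hc hx
  set F : ℂ → ℂ := fun z => f z - f (z - x) with hF
  have hshift : ∀ z ∈ strip r, MeromorphicAt (fun w => f (w - x)) z := fun z hz =>
    (hmer _ (sub_ofReal_mem_strip hz x)).comp_analyticAt (g := fun w => w - (x : ℂ)) (by fun_prop)
  have hFm : MeromorphicOn F⁻¹ (strip r) := fun z hz => ((hmer z hz).sub (hshift z hz)).inv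
  set h : ℂ → ℂ := toMeromorphicNFOn F⁻¹ (strip r) with hh
  have hnear : ∀ z ∈ strip r, ∀ᶠ w in 𝓝[≠] z, w ∈ strip r ∧
      c * ‖(x : UnitAddCircle)‖ ≤ ‖F w‖ ∧ h w = (F w)⁻¹ := by
    intro z hz
    filter_upwards [(hmer z hz).eventually_analyticAt, (hshift z hz).eventually_analyticAt,
      hFm.toMeromorphicNFOn_eq_self_on_nhdsNE hz,
      nhdsWithin_le_nhds ((isOpen_strip r).mem_nhds hz)] with w h1 h2 h3 h4
    exact ⟨h4, hsep w h4 h1 (analyticAt_of_comp_sub h2), h3⟩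
  have hbd : ∀ z ∈ strip r, ∀ᶠ w in 𝓝[≠] z, c * ‖(x : UnitAddCircle)‖ * ‖h w‖ ≤ 1 := by
    intro z hz
    filter_upwards [hnear z hz] with w hw
    rw [hw.2.2, norm_inv, ← div_eq_mul_inv]
    exact div_le_one_of_le₀ hw.2.1 (norm_nonneg _)
  have han : ∀ z ∈ strip r, AnalyticAt ℂ h z := by
    intro z hz
    have hnf : MeromorphicNFAt h z := meromorphicNFOn_toMeromorphicNFOn F⁻¹ (strip r) hz
    -- A pole of h would contradict its bound on punctured neighbourhoods, and without a pole the
    -- normal form is analytic.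
    refine hnf.meromorphicOrderAt_nonneg_iff_analyticAt.mp (not_lt.mp fun hlt => ?_)
    have ht := tendsto_norm_atTop_iff_cobounded.mpr (tendsto_cobounded_of_meromorphicOrderAt_neg hlt)
    obtain ⟨w, hw1, hw2⟩ := ((ht.eventually_gt_atTop (1 / (c * ‖(x : UnitAddCircle)‖))).and
      (hbd z hz)).exists
    rw [div_lt_iff₀ hcx] at hw1
    linarith
  refine ⟨h, ⟨fun z hz => (han z hz).differentiableAt.differentiableWithinAt, ?_⟩, fun z hz => ?_,
    fun z hz h1 h2 => ?_⟩
  · refine fun z hz n => apply_add_intCast_of_periodic (fun z hz => ?_) n z hz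
    have hz1 : z + 1 ∈ strip r := by simpa using add_intCast_mem_strip hz 1
    have hF1 : ∀ w ∈ strip r, F (w + 1) = F w := fun w hw => by
      simp only [hF]
      rw [hper w hw, add_sub_right_comm, hper _ (sub_ofReal_mem_strip hw x)]
    have ht : Tendsto (fun w : ℂ => w + 1) (𝓝[≠] z) (𝓝[≠] (z + 1)) := by
      refine tendsto_nhdsWithin_of_tendsto_nhds_of_eventually_within _
        ((continuous_add_const (1 : ℂ)).continuousAt.tendsto.mono_left nhdsWithin_le_nhds) ?_
      filter_upwards [self_mem_nhdsWithin] with w hw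
      simpa using hw
    have h1 : Tendsto (fun w => h (w + 1)) (𝓝[≠] z) (𝓝 (h (z + 1))) :=
      ((han _ hz1).continuousAt.tendsto.mono_left nhdsWithin_le_nhds).comp ht
    have h2 : Tendsto h (𝓝[≠] z) (𝓝 (h z)) :=
      (han z hz).continuousAt.tendsto.mono_left nhdsWithin_le_nhds
    refine tendsto_nhds_unique (h1.congr' ?_) h2
    filter_upwards [hnear z hz, ht.eventually (hnear _ hz1)] with w hw hw1
    rw [hw.2.2, hw1.2.2, hF1 w hw.1]
  · have hlim : Tendsto (fun w => c * ‖(x : UnitAddCircle)‖ * ‖h w‖) (𝓝[≠] z)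
        (𝓝 (c * ‖(x : UnitAddCircle)‖ * ‖h z‖)) :=
      (((han z hz).continuousAt.tendsto.mono_left nhdsWithin_le_nhds).norm).const_mul _
    exact le_of_tendsto hlim (hbd z hz)
  · have hFz : ContinuousAt F z :=
      h1.continuousAt.sub (ContinuousAt.comp (g := f) (f := fun w => w - (x : ℂ)) h2.continuousAt
        (by fun_prop))
    have hlim : Tendsto (fun w => F w * h w) (𝓝[≠] z) (𝓝 (F z * h z)) :=
      (hFz.mul (han z hz).continuousAt).tendsto.mono_left nhdsWithin_le_nhds
    refine tendsto_nhds_unique hlim (tendsto_const_nhds.congr' ?_)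
    filter_upwards [hnear z hz] with w hw
    rw [hw.2.2, mul_inv_cancel₀]
    intro h0
    rw [h0, norm_zero] at hw
    linarith [hw.2.1]

theorem Diophantine.norm_pos {d : ℕ} {τ γ : ℝ} {ω : Fin d → ℝ} (hω : Diophantine τ γ ω)
    (hγ : 0 < γ) {k : ZLat d} (hk : k ≠ 0) : 0 < ‖(latDot k ω : UnitAddCircle)‖ :=
  (div_pos hγ (Real.rpow_pos_of_pos (one_pos.trans_le (one_le_norm_of_ne_zero hk)) _)).trans_le
    (hω k hk)

theorem exists_divisorInverse {d : ℕ} {r c τ γ : ℝ} {f : ℂ → ℂ} {ω : Fin d → ℝ} (hr : 0 < r)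
    (hc : 0 < c) (hγ : 0 < γ) (hω : Diophantine τ γ ω) (hmer : MeromorphicOn f (strip r))
    (hper : ∀ z ∈ strip r, f (z + 1) = f z)
    (hsep : ∀ z ∈ strip r, ∀ x : ℝ, AnalyticAt ℂ f z → AnalyticAt ℂ f (z - x) →
      c * ‖(x : UnitAddCircle)‖ ≤ ‖f z - f (z - x)‖)
    (han : ∀ i : ZLat d, AnalyticAt ℂ f (latDot i ω : ℂ)) :
    ∃ h : ZLat d → ℂ → ℂ, DivisorInverse r c ω (fun i => f (latDot i ω : ℂ)) h := by
  have key := fun (k : ZLat d) (hk : k ≠ 0) => exists_divisorInverse_of_separated hc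
    (hω.norm_pos hγ hk) hmer hper fun z hz => hsep z hz (latDot k ω)
  choose! h h1 h2 h3 using key
  refine ⟨h, h1, h2, fun i j hij => ?_⟩
  have e : (latDot j ω : ℂ) = latDot i ω - latDot (i - j) ω := by
    rw [latDot_sub]; push_cast; ring
  have := h3 (i - j) (sub_ne_zero.mpr hij) (latDot i ω) (ofReal_mem_strip hr _) (han i)
    (by rw [← e]; exact han j)
  rwa [← e] at this

/-! ### Localization for the general class. -/

/-- Localization for a potential of class `𝔓_r`. -/
theorem exists_powerLawLocalized {d : ℕ} {τ γ δ s : ℝ} (hτ : 0 < τ) (hγ : 0 < γ) (hδ : 0 < δ)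
    (hs : (d : ℝ) + τ + 12 * δ < s) {r : ℝ} {f : ℂ → ℂ} (hr : 0 < r) (hf : MeroClass r f) :
    ∃ ε₀ : ℝ, 0 < ε₀ ∧
      ∀ (ω : Fin d → ℝ) (φ : ZLat d → ℝ),
        Diophantine τ γ ω →
        (∀ i : ZLat d, AnalyticAt ℂ f (latDot i ω : ℂ)) →
        PolyHopping s φ →
        hoppingNorm (s - (d : ℝ) / 2 - δ) φ ≤ ε₀ →
        PowerLawLocalized (latticeOp φ fun i => f (latDot i ω : ℂ))
          (s - τ - (d : ℝ) / 2 - 12 * δ) := by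
  have hd : (0 : ℝ) ≤ d := Nat.cast_nonneg d
  obtain ⟨c, hc, hsep⟩ := hf.separated
  set β : ℝ := (s - d - τ - 3 * δ) + (d + δ) with hβdef
  have hβ : (d : ℝ) < β := by rw [hβdef]; linarith
  set Sβ : ℝ := ∑' k : ZLat d, bracket k ^ (-β) with hSdef
  have hS0 : 0 ≤ Sβ := tsum_nonneg fun k => Real.rpow_nonneg (bracket_pos k).le _
  -- Gives both ζ ≤ 1/2, for the factor 2 in the eigenfunction bound, and ζ Sβ ≤ 1/2, for
  -- completeness.
  set ζ : ℝ := 1 / (2 * (Sβ + 1)) with hζdef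
  have hζ : 0 < ζ := by positivity
  -- b just exceeds d, a + b = s - δ is the interpolated decay, and m lies δ below a - τ. Then Y
  -- decays with exponent m + b = s - τ - 2δ, more than claimed.
  obtain ⟨κ, hκ, hmain⟩ := exists_diagonalization d (a := s - d - 2 * δ) (b := d + δ) (τ := τ)
    (γ := γ) (c := c) (R := r / 2) (m := s - d - τ - 3 * δ) (ζ := ζ) (by linarith) hτ hγ hc
    (half_pos hr) (by linarith) (by linarith) hζ
  refine ⟨κ ^ (((d : ℝ) / 2 + δ) / δ), Real.rpow_pos_of_pos hκ _, fun ω φ hω han hφ hn => ?_⟩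
  obtain ⟨h, hh⟩ := exists_divisorInverse hr hc hγ hω hf.meromorphic.meromorphicOn hf.periodic
    hsep han
  have hφb := abs_le_of_polyHopping hδ hκ.le hφ hn
  obtain ⟨Y, g, hY, hdef⟩ := hmain ω φ _ h hω (by rwa [mul_div_cancel₀ r two_ne_zero]) fun k => by
    have e : s - (d : ℝ) - 2 * δ + (d + δ) = s - δ := by ring
    rw [e]; exact hφb k
  have hφs : Summable fun k => (φ k : ℂ) := by
    refine Summable.of_norm_bounded ((summable_bracket_rpow (b := s - δ) (by linarith)).mul_left κ)
      fun k => ?_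
    rw [Complex.norm_real]; exact hφb k
  refine powerLawLocalized_of_defect_eq_zero hβ hζ.le ?_ ?_ hY ?_ hφs hdef
  · rw [hζdef, div_le_div_iff₀ (by positivity) two_pos]; linarith
  · rw [hζdef, div_mul_eq_mul_div, div_le_div_iff₀ (by positivity) two_pos]; linarith
  · rw [hβdef]; linarith

/-! ### The tangent and exponential potentials. -/

theorem two_mul_norm_le_abs_sin (x : ℝ) :
    2 * ‖(x : UnitAddCircle)‖ ≤ |Real.sin (Real.pi * x)| := by
  have hpi := Real.pi_pos
  set y : ℝ := x - round x with hy
  have hy2 : |y| ≤ 1 / 2 := abs_sub_round x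
  have e : Real.pi * x = Real.pi * y + (round x : ℤ) * Real.pi := by rw [hy]; ring
  have hs : |Real.sin (Real.pi * x)| = |Real.sin (Real.pi * y)| := by
    rw [e, Real.sin_add_int_mul_pi, abs_mul, abs_zpow, abs_neg, abs_one, one_zpow, one_mul]
  have h1 : |Real.pi * y| ≤ Real.pi / 2 := by
    rw [abs_mul, abs_of_pos hpi]
    have := mul_le_mul_of_nonneg_left hy2 hpi.le
    linarith
  have h2 := Real.mul_abs_le_abs_sin h1
  rw [hs, UnitAddCircle.norm_eq]
  refine le_trans (le_of_eq ?_) h2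
  rw [abs_mul, abs_of_pos hpi]
  field_simp
  rfl

theorem norm_cos_le_exp_abs_im (w : ℂ) : ‖Complex.cos w‖ ≤ Real.exp |w.im| := by
  have h1 : ‖Complex.exp (w * Complex.I)‖ ≤ Real.exp |w.im| := by
    rw [Complex.norm_exp, Real.exp_le_exp]
    simpa using neg_le_abs w.im
  have h2 : ‖Complex.exp (-w * Complex.I)‖ ≤ Real.exp |w.im| := by
    rw [Complex.norm_exp, Real.exp_le_exp]
    simpa using le_abs_self w.im
  have h3 := norm_add_le (Complex.exp (w * Complex.I)) (Complex.exp (-w * Complex.I))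
  rw [Complex.cos, norm_div, Complex.norm_ofNat, div_le_iff₀ two_pos]
  linarith

theorem analyticAt_tan_pi {z : ℂ} (hz : Complex.cos (Real.pi * z) ≠ 0) :
    AnalyticAt ℂ (fun z : ℂ => Complex.tan (Real.pi * z)) z := by
  have : (fun z : ℂ => Complex.tan (Real.pi * z)) =
      fun z : ℂ => Complex.sin (Real.pi * z) / Complex.cos (Real.pi * z) := rfl
  rw [this]
  exact AnalyticAt.div (by fun_prop) (by fun_prop) hz

open Filter Topology in
-- Where the cosine vanishes the sine does not. Continuity of the tangent there would let tan·cos =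
-- sin pass to the limit and give sin = 0.
theorem cos_ne_zero_of_analyticAt_tan_pi {z : ℂ}
    (h : AnalyticAt ℂ (fun z : ℂ => Complex.tan (Real.pi * z)) z) :
    Complex.cos (Real.pi * z) ≠ 0 := by
  intro h0
  have hcos : AnalyticAt ℂ (fun z : ℂ => Complex.cos (Real.pi * z)) z := by fun_prop
  have hsin : ContinuousAt (fun z : ℂ => Complex.sin (Real.pi * z)) z := by fun_prop
  have hsin0 : Complex.sin (Real.pi * z) ≠ 0 := by
    intro h1
    have := Complex.sin_sq_add_cos_sq (Real.pi * z)
    rw [h0, h1] at this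
    norm_num at this
  have hder : HasDerivAt (fun z : ℂ => Complex.cos (Real.pi * z))
      (-Complex.sin (Real.pi * z) * Real.pi) z := by
    have := (Complex.hasDerivAt_cos (Real.pi * z)).comp z
      ((hasDerivAt_id z).const_mul (Real.pi : ℂ))
    simpa [Function.comp_def] using this
  have hne : ∀ᶠ w in 𝓝[≠] z, Complex.cos (Real.pi * w) ≠ 0 :=
    hder.eventually_ne (mul_ne_zero (neg_ne_zero.mpr hsin0) (by exact_mod_cast Real.pi_ne_zero))
  have h1 : Tendsto (fun w : ℂ => Complex.tan (Real.pi * w) * Complex.cos (Real.pi * w)) (𝓝[≠] z)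
      (𝓝 (Complex.tan (Real.pi * z) * Complex.cos (Real.pi * z))) :=
    (h.continuousAt.mul hcos.continuousAt).tendsto.mono_left nhdsWithin_le_nhds
  have h2 : Tendsto (fun w : ℂ => Complex.sin (Real.pi * w)) (𝓝[≠] z)
      (𝓝 (Complex.sin (Real.pi * z))) := hsin.tendsto.mono_left nhdsWithin_le_nhds
  have h3 := tendsto_nhds_unique (h1.congr' (hne.mono fun w hw =>
    Complex.tan_mul_cos hw)) h2
  rw [h0, mul_zero] at h3
  exact hsin0 h3.symm

/-- Separation follows from tan a - tan b = sin(a-b)/(cos a cos b), with |cos(πw)| ≤ e^π on the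
strip. At a pole the normal form is checked on the reciprocal, which is analytic. -/
theorem meroClass_tan : MeroClass 1 fun z : ℂ => Complex.tan (Real.pi * z) where
  meromorphic := by
    intro z _
    by_cases hz : Complex.cos (Real.pi * z) = 0
    · have hsin0 : Complex.sin (Real.pi * z) ≠ 0 := by
        intro h1
        have := Complex.sin_sq_add_cos_sq (Real.pi * z)
        rw [hz, h1] at this
        norm_num at this
      have e : (fun z : ℂ => Complex.tan (Real.pi * z)) =
          (fun z : ℂ => Complex.cos (Real.pi * z) / Complex.sin (Real.pi * z))⁻¹ := by
        funext w
        simp [Complex.tan]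
      have hcot : AnalyticAt ℂ
          (fun z : ℂ => Complex.cos (Real.pi * z) / Complex.sin (Real.pi * z)) z :=
        AnalyticAt.div (by fun_prop) (by fun_prop) hsin0
      rw [e, meromorphicNFAt_inv]
      exact hcot.meromorphicNFAt
    · exact (analyticAt_tan_pi hz).meromorphicNFAt
  periodic := by
    intro z _
    rw [mul_add, mul_one, Complex.tan_add_pi]
  separated := by
    refine ⟨2 * Real.exp (-(2 * Real.pi)), by positivity, fun z hz x h1 h2 => ?_⟩
    have hpi := Real.pi_pos
    have c1 := cos_ne_zero_of_analyticAt_tan_pi h1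
    have c2 := cos_ne_zero_of_analyticAt_tan_pi h2
    have hcos : ∀ w ∈ strip 1, ‖Complex.cos (Real.pi * w)‖ ≤ Real.exp Real.pi := by
      intro w hw
      refine (norm_cos_le_exp_abs_im _).trans (Real.exp_le_exp.mpr ?_)
      have hw1 : |w.im| < 1 := hw
      rw [Complex.im_ofReal_mul, abs_mul, abs_of_pos hpi]
      exact mul_le_of_le_one_right hpi.le hw1.le
    have e : Complex.tan (Real.pi * z) - Complex.tan (Real.pi * (z - x)) =
        Complex.sin ((Real.pi * x : ℝ) : ℂ) /
          (Complex.cos (Real.pi * z) * Complex.cos (Real.pi * (z - x))) := by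
      have ea : ((Real.pi * x : ℝ) : ℂ) = Real.pi * z - Real.pi * (z - x) := by push_cast; ring
      rw [ea, Complex.sin_sub, Complex.tan, Complex.tan]
      field_simp
    rw [e, norm_div, norm_mul, ← Complex.ofReal_sin, Complex.norm_real, Real.norm_eq_abs,
      le_div_iff₀ (mul_pos (norm_pos_iff.mpr c1) (norm_pos_iff.mpr c2))]
    have hb := mul_le_mul (hcos z hz) (hcos _ (sub_ofReal_mem_strip hz x)) (norm_nonneg _)
      (Real.exp_pos _).le
    have hexp : Real.exp (-(2 * Real.pi)) * (Real.exp Real.pi * Real.exp Real.pi) = 1 := by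
      rw [← Real.exp_add, ← Real.exp_add, ← Real.exp_zero]; congr 1; ring
    calc _ ≤ 2 * Real.exp (-(2 * Real.pi)) * ‖(x : UnitAddCircle)‖ *
          (Real.exp Real.pi * Real.exp Real.pi) := by gcongr
      _ = 2 * ‖(x : UnitAddCircle)‖ *
          (Real.exp (-(2 * Real.pi)) * (Real.exp Real.pi * Real.exp Real.pi)) := by ring
      _ ≤ _ := by rw [hexp, mul_one]; exact two_mul_norm_le_abs_sin x

/-- The difference factors as e^{2πi(z-x)}(e^{2πix} - 1): the first modulus is at least e^{-2π} on
the strip, the second equals 2|sin πx|. -/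
theorem meroClass_exp : MeroClass 1 fun z : ℂ => Complex.exp (2 * Real.pi * Complex.I * z) where
  meromorphic := fun z _ => AnalyticAt.meromorphicNFAt (by fun_prop)
  periodic := by
    intro z _
    rw [mul_add, mul_one, Complex.exp_add, Complex.exp_two_pi_mul_I, mul_one]
  separated := by
    refine ⟨4 * Real.exp (-(2 * Real.pi)), by positivity, fun z hz x _ _ => ?_⟩
    have hpi := Real.pi_pos
    have e : Complex.exp (2 * Real.pi * Complex.I * z) -
        Complex.exp (2 * Real.pi * Complex.I * (z - x)) =
        Complex.exp (2 * Real.pi * Complex.I * (z - x)) *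
          (Complex.exp (Complex.I * (2 * (Real.pi * x) : ℝ)) - 1) := by
      rw [mul_sub_one, ← Complex.exp_add]; congr 2; push_cast; ring
    have h1 : Real.exp (-(2 * Real.pi)) ≤ ‖Complex.exp (2 * Real.pi * Complex.I * (z - x))‖ := by
      have hz1 : |z.im| < 1 := hz
      have er : (2 * Real.pi * Complex.I * (z - x)).re = -(2 * Real.pi * z.im) := by
        simp
      rw [Complex.norm_exp, Real.exp_le_exp, er, neg_le_neg_iff]
      exact mul_le_of_le_one_right (by positivity) ((le_abs_self _).trans hz1.le)
    have h2 : ‖Complex.exp (Complex.I * (2 * (Real.pi * x) : ℝ)) - 1‖ =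
        2 * |Real.sin (Real.pi * x)| := by
      rw [Complex.norm_exp_I_mul_ofReal_sub_one, mul_div_cancel_left₀ _ two_ne_zero, norm_mul,
        Real.norm_eq_abs, Real.norm_eq_abs, abs_two]
    rw [e, norm_mul, h2]
    have h3 := two_mul_norm_le_abs_sin x
    calc _ = Real.exp (-(2 * Real.pi)) * (2 * (2 * ‖(x : UnitAddCircle)‖)) := by ring
      _ ≤ _ := by gcongr

/-- Diophantine lattice points never hit the poles of `tan (π ·)`. -/
theorem Diophantine.cos_pi_latDot_ne_zero {d : ℕ} {τ γ : ℝ} {ω : Fin d → ℝ}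
    (hω : Diophantine τ γ ω) (hγ : 0 < γ) (i : ZLat d) :
    Complex.cos (Real.pi * (latDot i ω : ℂ)) ≠ 0 := by
  intro h0
  rw [Complex.cos_eq_zero_iff] at h0
  obtain ⟨k, hk⟩ := h0
  have hpi : (Real.pi : ℂ) ≠ 0 := by exact_mod_cast Real.pi_ne_zero
  have h1 : (2 * latDot i ω : ℂ) = 2 * k + 1 := by
    have : (Real.pi : ℂ) * (2 * latDot i ω) = Real.pi * (2 * k + 1) := by
      linear_combination 2 * hk
    exact mul_left_cancel₀ hpi this
  have h2 : 2 * latDot i ω = ((2 * k + 1 : ℤ) : ℝ) := by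
    exact_mod_cast h1
  have hi : i ≠ 0 := by
    rintro rfl
    have h3 : latDot (0 : ZLat d) ω = 0 := by simp [latDot]
    rw [h3, mul_zero] at h2
    have h4 : (0 : ℤ) = 2 * k + 1 := by exact_mod_cast h2
    omega
  -- If i·ω were a half-integer, (2i)·ω would be an integer, which the Diophantine condition at 2i
  -- excludes.
  have h5 : (2 : ℤ) • i ≠ 0 := smul_ne_zero two_ne_zero hi
  have h6 := hω.norm_pos hγ h5
  have h7 : latDot ((2 : ℤ) • i) ω = ((2 * k + 1 : ℤ) : ℝ) := by
    rw [← h2]; simp [latDot, Finset.mul_sum, mul_assoc]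
  rw [h7, UnitAddCircle.norm_eq, round_intCast, sub_self, abs_zero] at h6
  exact h6.false

end

theorem mainTheorem7 (d : ℕ) (α₀ τ γ δ s : ℝ)
    (hα₀ : (d : ℝ) / 2 < α₀) (hτ : 0 < τ) (hγ : 0 < γ) (hδ : 0 < δ)
    (hs : α₀ + τ + (d : ℝ) / 2 + 12 * δ < s) :
    (∀ (r : ℝ) (f : ℂ → ℂ), 0 < r → MeroClass r f →
      ∃ ε₀ : ℝ, 0 < ε₀ ∧
        ∀ (ω : Fin d → ℝ) (φ : ZLat d → ℝ),
          Diophantine τ γ ω →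
          (∀ i : ZLat d, AnalyticAt ℂ f (latDot i ω : ℂ)) →
          PolyHopping s φ →
          hoppingNorm (s - (d : ℝ) / 2 - δ) φ ≤ ε₀ →
          PowerLawLocalized (latticeOp φ fun i => f (latDot i ω : ℂ))
            (s - τ - (d : ℝ) / 2 - 12 * δ)) ∧
    (∃ ε₀ : ℝ, 0 < ε₀ ∧
      ∀ (ω : Fin d → ℝ) (φ : ZLat d → ℝ),
        Diophantine τ γ ω →
        PolyHopping s φ →
        hoppingNorm (s - (d : ℝ) / 2 - δ) φ ≤ ε₀ →
        PowerLawLocalized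
          (latticeOp φ fun i => (Real.tan (Real.pi * latDot i ω) : ℂ))
          (s - τ - (d : ℝ) / 2 - 12 * δ)) ∧
    (∃ ε₀ : ℝ, 0 < ε₀ ∧
      ∀ (ω : Fin d → ℝ) (φ : ZLat d → ℝ),
        Diophantine τ γ ω →
        PolyHopping s φ →
        hoppingNorm (s - (d : ℝ) / 2 - δ) φ ≤ ε₀ →
        PowerLawLocalized
          (latticeOp φ fun i => Complex.exp (2 * Real.pi * Complex.I * (latDot i ω : ℂ)))
          (s - τ - (d : ℝ) / 2 - 12 * δ)) := by
  -- The condition α₀ > d/2 enters through this inequality.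
  have hs' : (d : ℝ) + τ + 12 * δ < s := by linarith
  refine ⟨fun r f hr hf => exists_powerLawLocalized hτ hγ hδ hs' hr hf, ?_, ?_⟩
  · obtain ⟨ε₀, hε₀, h⟩ := exists_powerLawLocalized hτ hγ hδ hs' one_pos meroClass_tan
    refine ⟨ε₀, hε₀, fun ω φ hω hφ hn => ?_⟩
    have := h ω φ hω (fun i => analyticAt_tan_pi (hω.cos_pi_latDot_ne_zero hγ i)) hφ hn
    simpa only [Complex.ofReal_tan, Complex.ofReal_mul] using this
  · obtain ⟨ε₀, hε₀, h⟩ := exists_powerLawLocalized hτ hγ hδ hs' one_pos meroClass_exp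
    exact ⟨ε₀, hε₀, fun ω φ hω hφ hn => h ω φ hω (fun i => by fun_prop) hφ hn⟩
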